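/- Let $\mathcal{K}=\langle\mathcal{T},\mathcal{D}\rangle$ range over $\mathcal{EL}_\bot$ knowledge bases: $\mathcal{T}$ is a finite set of classical inclusions $E\sqsubseteq F$ and $\mathcal{D}$ a finite set of defeasible inclusions $E\mathrel{\sqsubset\!\sim} F$, where concepts are built from atomic concepts, $\top$, $\bot$, $\sqcap$ and $\exists r.$ *Rational closure.* A ranked interpretation is an interpretation with a relation $o\prec p \Leftrightarrow \mathrm{rk}(o)<\mathrm{rk}(p)$ for some $\mathrm{rk}:\Delta\to\mathbb{N}$; it satisfies $E\sqsubseteq F$ iff $E^R\subseteq F^R$, and $E\mathrel{\sqsubset\!\sim} F$ iff $\min_\prec E^R\subseteq F^R$. A concept $C$ (possibly with negation) is exceptional w.r.t. $\mathcal{K}$ iff every ranked model of $\mathcal{K}$ satisfies $\top\mathrel{\sqsubset\!\sim}\neg C$. Let $\mathcal{D}^0=\mathcal{D}$ and let $\mathcal{D}^{i+1}$ be the set of those $E\mathrel{\sqsubset\!\sim} F\in\mathcal{D}^i$ for which $E$ is exceptional w.r.t. $\langle\mathcal{T},\mathcal{D}^i\rangle$; $r_{\mathcal{K}}(C)$ is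 the least $i$ such that $C$ is not exceptional w.r.t. $\langle\mathcal{T},\mathcal{D}^i\rangle$, and $\infty$ if there is none. $C\mathrel{\sqsubset\!\sim} D$ is in the rational closure (RC) of $\mathcal{K}$ iff $r_{\mathcal{K}}(C\sqcap D)<r_{\mathcal{K}}(C\sqcap\neg D)$ or $r_{\mathcal{K}}(C)=\infty$. *Procedures.* For a fresh atomic concept $\delta$ put $\mathcal{T}_{\delta,\mathcal{E}}=\mathcal{T}\cup\{E\sqcap\delta\sqsubseteq F\mid E\mathrel{\sqsubset\!\sim} F\in\mathcal{E}\}$. $\mathtt{Exceptional}(\mathcal{T},\mathcal{E})$ tests $\mathcal{T}_{\delta,\mathcal{E}}\models E\sqcap\delta\sqsubseteq\bot$ for each $E\mathrel{\sqsubset\!\sim} F\in\mathcal{E}$ and returns the axioms for which the test succeeds. $\mathtt{ComputeRanking}(\mathcal{K})$ starts with $\mathcal{T}^*=\mathcal{T}$, $\mathcal{D}^*=\mathcal{D}$ and repeats: compute $\mathcal{E}_0=\mathcal{D}^*$, $\mathcal{E}_{j+1}=\mathtt{Exceptional}(\mathcal{T}^*,\mathcal{E}_j)$ until $\mathcal{E}_{i+1}=\mathcal{E}_i=:\mathcal{D}_\infty$;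 remove $\mathcal{D}_\infty$ from $\mathcal{D}^*$ and add $E\sqsubseteq\bot$ to $\mathcal{T}^*$ for each $E\mathrel{\sqsubset\!\sim} F\in\mathcal{D}_\infty$; until $\mathcal{D}_\infty=\emptyset$. It returns $\mathcal{T}^*$, $\mathcal{D}^*$ and the sets $\mathcal{D}_j=\mathcal{E}_j\setminus\mathcal{E}_{j+1}$ ($0\le j<i$) of the last round. $\mathtt{RationalClosure}(\mathcal{K},C\mathrel{\sqsubset\!\sim} D)$ returns true if $\mathcal{T}\models C\sqsubseteq D$; otherwise it runs $\mathtt{ComputeRanking}(\mathcal{K})$ and returns true if $\mathcal{T}^*\models C\sqsubseteq D$; otherwise, starting from $\mathcal{D}_R=\mathcal{D}^*$ and $i=0$, while $\mathcal{T}^*_{\delta,\mathcal{D}_R}\models C\sqcap\delta\sqsubseteq\bot$ and $\mathcal{D}_R\neq\emptyset$ it removes $\mathcal{D}_i$ from $\mathcal{D}_R$ and increments $i$; finally, if $\mathcal{T}^*_{\delta,\mathcal{D}_R}\not\models C\sqcap\delta\sqsubseteq\bot$, it returns the truth value of $\mathcal{T}^*_{\delta,\mathcal{D}_R}\models C\sqcap\delta\sqsubseteq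 D$, and otherwise false. *Claim.* 1. There is a constant $c$ such that, for all $\mathcal{K}$, $C$, $D$, $\mathtt{ComputeRanking}(\mathcal{K})$ makes at most $c\,|\mathcal{D}|^3$ classical $\mathcal{EL}_\bot$ subsumption tests, and $\mathtt{RationalClosure}(\mathcal{K},C\mathrel{\sqsubset\!\sim} D)$ makes at most $c\,(|\mathcal{D}|^3+|\mathcal{D}|)$ of them if $\mathcal{D}\neq\emptyset$, and at most $c$ if $\mathcal{D}=\emptyset$. The size of every test is bounded by a polynomial in the size of the input. 2. $\mathtt{RationalClosure}(\mathcal{K},C\mathrel{\sqsubset\!\sim} D)$ returns true if and only if $C\mathrel{\sqsubset\!\sim} D$ is in the RC of $\mathcal{K}$. 3. The output of $\mathtt{ComputeRanking}(\mathcal{K})$ can be computed in time polynomial in the size of $\mathcal{K}$, and it can be decided in time polynomial in the size of the input $(\mathcal{K},C\mathrel{\sqsubset\!\sim} D)$ whether $C\mathrel{\sqsubset\!\sim} D$ is in the RC of $\mathcal{K}$. -/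

import Mathlib

/-! ## Concepts, axioms, knowledge bases

Atomic concepts and atomic roles are named by natural numbers, so that a fresh atomic concept is
always available. -/

namespace DefeasibleEL

/-- Concepts of the description logic ALC. -/
inductive ALC : Type
  | atom (A : ℕ) : ALC
  | top : ALC
  | bot : ALC
  | inf (C D : ALC) : ALC
  | ex (r : ℕ) (C : ALC) : ALC
  | neg (C : ALC) : ALC

/-- Concepts of the description logic EL with bottom. -/
inductive EL : Type
  | atom (A : ℕ) : EL
  | top : EL
  | bot : EL
  | inf (C D : EL) : EL
  | ex (r : ℕ) (C : EL) : EL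
  deriving DecidableEq

/-- EL with bottom is the negation-free fragment of ALC. -/
def EL.toALC : EL → ALC
  | .atom A => .atom A
  | .top => .top
  | .bot => .bot
  | .inf C D => .inf C.toALC D.toALC
  | .ex r C => .ex r C.toALC

/-- A classical concept inclusion `lhs ⊑ rhs`. -/
structure GCI : Type where
  lhs : EL
  rhs : EL
  deriving DecidableEq

/-- A defeasible concept inclusion: typically, an instance of `lhs` is an instance of `rhs`. -/
structure DGCI : Type where
  lhs : EL
  rhs : EL
  deriving DecidableEq

/-- A TBox: a finite set of classical inclusions, given as a list. -/
abbrev TBox : Type := List GCI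

/-- A DBox: a finite set of defeasible inclusions, given as a list. -/
abbrev DBox : Type := List DGCI

/-- A knowledge base (ontology) `⟨T, D⟩`. -/
structure KB : Type where
  tbox : TBox
  dbox : DBox

/-! ## Classical semantics -/

/-- An interpretation with domain `Δ` (non-emptiness of `Δ` is demanded where interpretations are
quantified over). -/
structure Interp (Δ : Type) where
  conc : ℕ → Set Δ
  role : ℕ → Δ → Δ → Prop

/-- The extension of an ALC concept. -/
def ALC.ext {Δ : Type} (I : Interp Δ) : ALC → Set Δ
  | .atom A => I.conc A
  | .top => Set.univ
  | .bot => ∅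
  | .inf C D => C.ext I ∩ D.ext I
  | .ex r C => {o | ∃ o', I.role r o o' ∧ o' ∈ C.ext I}
  | .neg C => (C.ext I)ᶜ

/-- The interpretation satisfies the classical inclusion. -/
def Interp.Sat {Δ : Type} (I : Interp Δ) (g : GCI) : Prop :=
  g.lhs.toALC.ext I ⊆ g.rhs.toALC.ext I

/-- Classical entailment `T ⊨ g`: every model of `T` is a model of `g`. -/
def Entails (T : TBox) (g : GCI) : Prop :=
  ∀ (Δ : Type) [Nonempty Δ] (I : Interp Δ), (∀ g' ∈ T, I.Sat g') → I.Sat g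

/-! ## Ranked semantics and rational closure -/

/-- A ranked interpretation: an interpretation with a modular preference relation. -/
structure RankedInterp (Δ : Type) extends Interp Δ where
  prec : Δ → Δ → Prop
  modular : ∃ rk : Δ → ℕ, ∀ o p, prec o p ↔ rk o < rk p

/-- The preferred (most typical) elements of a set. -/
def RankedInterp.minimals {Δ : Type} (R : RankedInterp Δ) (X : Set Δ) : Set Δ :=
  {x | x ∈ X ∧ ¬ ∃ y ∈ X, R.prec y x}

/-- Satisfaction of the defeasible inclusion with left-hand side `C` and right-hand side `D`. -/
def RankedInterp.SatD {Δ : Type} (R : RankedInterp Δ) (C D : ALC) : Prop :=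
  R.minimals (C.ext R.toInterp) ⊆ D.ext R.toInterp

/-- `R` is a ranked model of the knowledge base. -/
def RankedInterp.IsModel {Δ : Type} (R : RankedInterp Δ) (K : KB) : Prop :=
  (∀ g ∈ K.tbox, R.toInterp.Sat g) ∧ (∀ d ∈ K.dbox, R.SatD d.lhs.toALC d.rhs.toALC)

/-- Ranked entailment of a defeasible inclusion. -/
def RankedEntails (K : KB) (C D : ALC) : Prop :=
  ∀ (Δ : Type) [Nonempty Δ] (R : RankedInterp Δ), R.IsModel K → R.SatD C D

/-- `C` is exceptional w.r.t. `K`: typically, nothing is a `C`. -/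
def Exceptional (K : KB) (C : ALC) : Prop :=
  RankedEntails K .top (.neg C)

open Classical in
/-- `remaining K i` is the DBox without its axioms of rank `< i`: the axioms of rank `i` are those
axioms of `remaining K i` whose left-hand side is not exceptional w.r.t. `⟨T, remaining K i⟩`. -/
noncomputable def remaining (K : KB) : ℕ → DBox
  | 0 => K.dbox
  | i + 1 => (remaining K i).filter
      fun d => decide (Exceptional ⟨K.tbox, remaining K i⟩ d.lhs.toALC)

/-- The rank of a concept: the least `i` such that the concept is not exceptional w.r.t.
`⟨T, remaining K i⟩`, and `∞` if there is no such `i`. -/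
noncomputable def rank (K : KB) (C : ALC) : ℕ∞ :=
  sInf {m : ℕ∞ | ∃ i : ℕ, m = i ∧ ¬ Exceptional ⟨K.tbox, remaining K i⟩ C}

/-- The defeasible inclusion with left-hand side `C` and right-hand side `D` is in the rational
closure of `K`. -/
def InRC (K : KB) (C D : EL) : Prop :=
  rank K (.inf C.toALC D.toALC) < rank K (.inf C.toALC (.neg D.toALC)) ∨ rank K C.toALC = ⊤

/-! ## Procedures that use classical subsumption tests as a black box -/

/-- A procedure with result in `α` that may ask classical subsumption tests `T ⊨ g`; the answer to a
test is passed on to the rest of the procedure. -/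
inductive Proc (α : Type) : Type
  | done (a : α) : Proc α
  | test (T : TBox) (g : GCI) (k : Bool → Proc α) : Proc α

/-- Sequential composition. -/
def Proc.bind {α β : Type} : Proc α → (α → Proc β) → Proc β
  | .done a, f => f a
  | .test T g k, f => .test T g fun b => (k b).bind f

instance : Monad Proc where
  pure := .done
  bind := .bind

/-- The procedure that asks one test and returns the answer. -/
def ask (T : TBox) (g : GCI) : Proc Bool := .test T g .done

/-- Execution when the tests are answered by `oracle`: the result, and the list of the tests that
have been made. -/
def Proc.runWith {α : Type} (oracle : TBox → GCI → Bool) : Proc α → α × List (TBox × GCI)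
  | .done a => (a, [])
  | .test T g k =>
      (((k (oracle T g)).runWith oracle).1, (T, g) :: ((k (oracle T g)).runWith oracle).2)

open Classical in
/-- Execution when the tests are answered correctly. -/
noncomputable def Proc.run {α : Type} (P : Proc α) : α × List (TBox × GCI) :=
  P.runWith fun T g => decide (Entails T g)

/-- The result of a procedure. -/
noncomputable def Proc.result {α : Type} (P : Proc α) : α := P.run.1

/-- The classical subsumption tests that a procedure makes, in order and with repetitions. -/
noncomputable def Proc.tests {α : Type} (P : Proc α) : List (TBox × GCI) := P.run.2

/-! ## The procedures Exceptional, ComputeRanking and RationalClosure -/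

/-- A bound strictly above all atomic concepts of a concept. -/
def EL.bound : EL → ℕ
  | .atom A => A + 1
  | .top => 0
  | .bot => 0
  | .inf C D => max C.bound D.bound
  | .ex _ C => C.bound

/-- An atomic concept that occurs neither in `T`, nor in `E`, nor in the concepts `Cs`. -/
def freshAtom (T : TBox) (E : DBox) (Cs : List EL) : ℕ :=
  ((T.map fun g => max g.lhs.bound g.rhs.bound) ++ (E.map fun d => max d.lhs.bound d.rhs.bound) ++
    Cs.map EL.bound).foldr max 0

/-- `T ∪ {E ⊓ δ ⊑ F | E ⊏∼ F ∈ E}`. -/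
def withDelta (T : TBox) (δ : ℕ) (E : DBox) : TBox :=
  T ++ E.map fun d => ⟨.inf d.lhs (.atom δ), d.rhs⟩

/-- Set difference. -/
def DBox.diff (E E' : DBox) : DBox := E.filter fun d => decide (d ∉ E')

/-- The loop of `exceptional` through the axioms of its argument. -/
def exceptionalLoop (T : TBox) (δ : ℕ) : (E : DBox) → Proc {E' : DBox // E'.Sublist E}
  | [] => pure ⟨[], .slnil⟩
  | d :: E => do
      let b ← ask T ⟨.inf d.lhs (.atom δ), .bot⟩
      let E' ← exceptionalLoop T δ E
      pure (if b then ⟨d :: E'.1, E'.2.cons_cons d⟩ else ⟨E'.1, E'.2.cons d⟩)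

/-- Procedure Exceptional: the axioms of `E` that are found exceptional w.r.t. `⟨T, E⟩`. -/
def exceptional (T : TBox) (E : DBox) : Proc {E' : DBox // E'.Sublist E} :=
  exceptionalLoop (withDelta T (freshAtom T E []) E) (freshAtom T E []) E

/-- Inner loop of ComputeRanking. It starts with `E = E₀`, computes
`E_{j+1} = exceptional T E_j` until `E_{i+1} = E_i`, and returns `[E₀, …, E_i]` and `E_i`. -/
def exceptionalChain (T : TBox) (E : DBox) :
    Proc (List DBox × {E' : DBox // E'.Sublist E}) := do
  let ⟨E', h⟩ ← exceptional T E
  if _hE : E' = E then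
    pure ([E], ⟨E, List.Sublist.refl E⟩)
  else
    let ⟨chain, ⟨last, hlast⟩⟩ ← exceptionalChain T E'
    pure (E :: chain, ⟨last, hlast.trans h⟩)
termination_by E.length
decreasing_by
  exact lt_of_le_of_ne h.length_le fun hl => _hE (h.eq_of_length hl)

/-- The output of ComputeRanking: `⟨T*, D*⟩` and the partition `D₀, …, D_n` of `D*`. -/
structure Ranking : Type where
  tbox : TBox
  dbox : DBox
  ranks : List DBox

theorem DBox.diff_length_lt {E E' : DBox} (h : E'.Sublist E) (hne : E' ≠ []) :
    (E.diff E').length < E.length := by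
  obtain ⟨d, hd⟩ := List.exists_mem_of_ne_nil E' hne
  unfold DBox.diff
  rw [List.length_filter_lt_length_iff_exists]
  exact ⟨d, h.subset hd, by simp [hd]⟩

/-- The repeat loop of ComputeRanking, followed by the computation of the partition
`D_{j-1} = E_{j-1} \ E_j`. -/
def rankingLoop (T : TBox) (D : DBox) : Proc Ranking := do
  let ⟨chain, ⟨Dinf, h⟩⟩ ← exceptionalChain T D
  if _hD : Dinf = [] then
    pure
      { tbox := T
        dbox := D
        ranks := List.zipWith DBox.diff chain chain.tail }
  else
    rankingLoop (T ++ Dinf.map fun d => ⟨d.lhs, .bot⟩) (D.diff Dinf)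
termination_by D.length
decreasing_by
  exact DBox.diff_length_lt h _hD

/-- Procedure ComputeRanking. -/
def computeRanking (K : KB) : Proc Ranking := rankingLoop K.tbox K.dbox

/-- The while loop of RationalClosure, with current set `DR` of defeasible axioms; the first
argument holds `D_i, D_{i+1}, …, D_n`. It returns the final `DR`. (The loop is only entered with
`DR = D_i ∪ … ∪ D_n`, so that its second line is never reached with `DR ≠ []`.) -/
def rankSearch (T : TBox) (C D : EL) : List DBox → DBox → Proc DBox
  | [], DR => do
      let _ ← ask (withDelta T (freshAtom T DR [C, D]) DR)
        ⟨.inf C (.atom (freshAtom T DR [C, D])), .bot⟩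
      pure DR
  | Di :: ranks, DR => do
      let b ← ask (withDelta T (freshAtom T DR [C, D]) DR)
        ⟨.inf C (.atom (freshAtom T DR [C, D])), .bot⟩
      if b = true ∧ DR ≠ [] then rankSearch T C D ranks (DR.diff Di) else pure DR

/-- Procedure RationalClosure, for the knowledge base `K` and the defeasible inclusion with
left-hand side `C` and right-hand side `D`. -/
def rationalClosure (K : KB) (C D : EL) : Proc Bool := do
  let cl ← ask K.tbox ⟨C, D⟩
  if cl then
    pure cl
  else
    let R ← computeRanking K
    let cl ← ask R.tbox ⟨C, D⟩
    if cl then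
      pure cl
    else
      let DR ← rankSearch R.tbox C D R.ranks R.dbox
      let δ := freshAtom R.tbox DR [C, D]
      let b ← ask (withDelta R.tbox δ DR) ⟨.inf C (.atom δ), .bot⟩
      if !b then
        ask (withDelta R.tbox δ DR) ⟨.inf C (.atom δ), D⟩
      else
        pure cl

/-! ## Machine model: while-programs on binary trees

Every evaluation step is charged the size of the value that it produces, so that a multitape Turing
machine that stores trees as bracket words simulates a run with polynomial overhead; conversely
tapes are trees, and a while-program simulates a Turing machine with polynomial overhead. -/

/-- Data: binary trees. -/
inductive Tree : Type
  | nil : Tree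
  | cons (l r : Tree) : Tree
  deriving DecidableEq

/-- The number of nodes. -/
def Tree.size : Tree → ℕ
  | .nil => 1
  | .cons l r => l.size + r.size + 1

/-- The left subtree (`nil` for `nil`). -/
def Tree.left : Tree → Tree
  | .nil => .nil
  | .cons l _ => l

/-- The right subtree (`nil` for `nil`). -/
def Tree.right : Tree → Tree
  | .nil => .nil
  | .cons _ r => r

/-- Expressions over program variables, which are named by natural numbers. -/
inductive Expr : Type
  | var (x : ℕ) : Expr
  | nil : Expr
  | cons (e f : Expr) : Expr
  | left (e : Expr) : Expr
  | right (e : Expr) : Expr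

/-- Memory: the values of the program variables. -/
abbrev Store : Type := ℕ → Tree

/-- The value of an expression. -/
def Expr.eval (s : Store) : Expr → Tree
  | .var x => s x
  | .nil => .nil
  | .cons e f => .cons (e.eval s) (f.eval s)
  | .left e => (e.eval s).left
  | .right e => (e.eval s).right

/-- The cost of the evaluation of an expression: the sum of the sizes of the values of all
its subexpressions. -/
def Expr.cost (s : Store) : Expr → ℕ
  | .var x => (s x).size
  | .nil => 1
  | .cons e f => e.cost s + f.cost s + (Expr.eval s (.cons e f)).size
  | .left e => e.cost s + (Expr.eval s (.left e)).size
  | .right e => e.cost s + (Expr.eval s (.right e)).size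

/-- While-programs. A test succeeds if its value is not `nil`. -/
inductive Prog : Type
  | assign (x : ℕ) (e : Expr) : Prog
  | seq (p q : Prog) : Prog
  | ite (e : Expr) (p q : Prog) : Prog
  | loop (e : Expr) (p : Prog) : Prog

/-- `Run p s s' t`: started in the store `s`, the program `p` halts with the store `s'` after time
`t`. -/
inductive Run : Prog → Store → Store → ℕ → Prop
  | assign (x : ℕ) (e : Expr) (s : Store) :
      Run (.assign x e) s (Function.update s x (e.eval s)) (e.cost s)
  | seq {p q : Prog} {s s' s'' : Store} {t t' : ℕ} :
      Run p s s' t → Run q s' s'' t' → Run (.seq p q) s s'' (t + t')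
  | ite_true {e : Expr} {p q : Prog} {s s' : Store} {t : ℕ} :
      e.eval s ≠ .nil → Run p s s' t → Run (.ite e p q) s s' (e.cost s + t)
  | ite_false {e : Expr} {p q : Prog} {s s' : Store} {t : ℕ} :
      e.eval s = .nil → Run q s s' t → Run (.ite e p q) s s' (e.cost s + t)
  | loop_true {e : Expr} {p : Prog} {s s' s'' : Store} {t t' : ℕ} :
      e.eval s ≠ .nil → Run p s s' t → Run (.loop e p) s' s'' t' →
        Run (.loop e p) s s'' (e.cost s + t + t')
  | loop_false {e : Expr} {p : Prog} {s : Store} :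
      e.eval s = .nil → Run (.loop e p) s s (e.cost s)

/-- The initial store: the input is the value of variable `0`, all other variables are `nil`. -/
def inputStore (a : Tree) : Store := fun x => if x = 0 then a else .nil

/-- `f` is computed by a while-program in time polynomial in the size of the input; the output is
the final value of variable `0`. -/
def ComputableInPolyTime {α β : Type} (ea : α → Tree) (eb : β → Tree) (f : α → β) : Prop :=
  ∃ (p : Prog) (q : Polynomial ℕ), ∀ a : α, ∃ (s : Store) (t : ℕ),
    Run p (inputStore (ea a)) s t ∧ t ≤ q.eval (ea a).size ∧ s 0 = eb (f a)

/-- The property `P` is decided by a while-program in time polynomial in the size of the input;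
the input is accepted if the final value of variable `0` is not `nil`. -/
def DecidableInPolyTime {α : Type} (ea : α → Tree) (P : α → Prop) : Prop :=
  ∃ (p : Prog) (q : Polynomial ℕ), ∀ a : α, ∃ (s : Store) (t : ℕ),
    Run p (inputStore (ea a)) s t ∧ t ≤ q.eval (ea a).size ∧ (s 0 ≠ .nil ↔ P a)

/-! ## Encodings of the inputs and outputs as trees -/

/-- Small numbers in unary, used as constructor tags. -/
def encodeTag : ℕ → Tree
  | 0 => .nil
  | n + 1 => .cons .nil (encodeTag n)

/-- Lists. -/
def encodeList {α : Type} (e : α → Tree) : List α → Tree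
  | [] => .nil
  | a :: l => .cons (e a) (encodeList e l)

/-- Bits. -/
def encodeBit (b : Bool) : Tree := if b then .cons .nil .nil else .nil

/-- Names of atomic concepts and roles are written in binary. -/
def encodeName (n : ℕ) : Tree := encodeList encodeBit n.bits

/-- Concepts. -/
def encodeEL : EL → Tree
  | .top => .cons (encodeTag 0) .nil
  | .bot => .cons (encodeTag 1) .nil
  | .atom A => .cons (encodeTag 2) (encodeName A)
  | .inf C D => .cons (encodeTag 3) (.cons (encodeEL C) (encodeEL D))
  | .ex r C => .cons (encodeTag 4) (.cons (encodeName r) (encodeEL C))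

/-- Classical inclusions. -/
def encodeGCI (g : GCI) : Tree := .cons (encodeEL g.lhs) (encodeEL g.rhs)

/-- Defeasible inclusions. -/
def encodeDGCI (d : DGCI) : Tree := .cons (encodeEL d.lhs) (encodeEL d.rhs)

/-- TBoxes. -/
def encodeTBox (T : TBox) : Tree := encodeList encodeGCI T

/-- DBoxes. -/
def encodeDBox (D : DBox) : Tree := encodeList encodeDGCI D

/-- Knowledge bases. -/
def encodeKB (K : KB) : Tree := .cons (encodeTBox K.tbox) (encodeDBox K.dbox)

/-- Rankings. -/
def encodeRanking (R : Ranking) : Tree :=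
  .cons (encodeTBox R.tbox) (.cons (encodeDBox R.dbox) (encodeList encodeDBox R.ranks))

/-- Classical subsumption tests. -/
def encodeTest (τ : TBox × GCI) : Tree := .cons (encodeTBox τ.1) (encodeGCI τ.2)

/-- Inputs of the decision problem: a knowledge base and a defeasible inclusion. -/
def encodeInput (a : KB × DGCI) : Tree := .cons (encodeKB a.1) (encodeDGCI a.2)

end DefeasibleEL

namespace DefeasibleEL

/-! ## Polynomial-time functions on trees -/

/-! Semantics. Interpreting the fresh atom `δ` as a singleton shows that a test with `δ` on the left
asks for one point of a model of `T` that satisfies, as plain implications, all axioms of `E`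
(`MatEntails`, `entails_withDelta_iff`). A minimal point of a ranked model is minimal in every set
it belongs to, so it satisfies these implications. Hence a concept that is inconsistent with them is
exceptional.

The converse can fail when the sequence of exceptional sets gets stuck at a nonempty set. The
left-hand sides of such a set are empty in every ranked model (`satisfies_emptyAxioms`), which is
why ComputeRanking replaces its axioms by inclusions in `⊥`. Afterwards the sequence reaches the
empty set. A disjoint union of witnesses, each point ranked by the first stage whose implications it
satisfies, is then a ranked model (`exists_rankedModel`). So semantic exceptionality and the test
agree at every stage (`exceptional_iff`), although the semantic stages retain the discarded axioms
forever (`mem_remaining_iff`). At the first stage where `C` is consistent, membership in the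
rational closure is a single entailment (`inRC_iff`).

Complexity. `Poly` is closed under composition, pairing, case distinction and loops whose states and
measure are polynomially bounded. Entailment is decided by a saturation in which a formal point
`none` replaces `δ`; completeness comes from a canonical model (`sub_iff`). The procedures thus
equal oracle-free functions on lists that lie in `Poly`. The test counts follow from strictly
shrinking lists, and the test sizes from the potential `esize T + 2 * esize D`, which no round of
ComputeRanking increases. -/

theorem eval_mono (q : Polynomial ℕ) {m n : ℕ} (h : m ≤ n) : q.eval m ≤ q.eval n := by
  induction q using Polynomial.induction_on' with
  | add p q hp hq => simpa using Nat.add_le_add hp hq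
  | monomial k a => simpa using Nat.mul_le_mul_left a (Nat.pow_le_pow_left h k)

theorem Tree.size_pos (a : Tree) : 1 ≤ a.size := by cases a <;> simp [Tree.size]

theorem Tree.size_left (a : Tree) : a.left.size ≤ a.size := by
  cases a <;> simp [Tree.size, Tree.left]; omega

theorem Tree.size_right (a : Tree) : a.right.size ≤ a.size := by
  cases a <;> simp [Tree.size, Tree.right]; omega

/-- There is a program that, from any store in which variable `0` has the value `i a`, computes the
value `o a` of variable `0`. It keeps all variables from some `k` on, and its time and output size
are polynomial in the size of `i a`. -/
def Transforms {ι : Type} (i o : ι → Tree) : Prop :=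
  ∃ (p : Prog) (k : ℕ) (q : Polynomial ℕ), 0 < k ∧ ∀ (a : ι) (s : Store), s 0 = i a →
    ∃ (s' : Store) (t : ℕ), Run p s s' t ∧ s' 0 = o a ∧ (∀ x, k ≤ x → s' x = s x) ∧
      t ≤ q.eval (i a).size ∧ (o a).size ≤ q.eval (i a).size

namespace Transforms

variable {ι κ : Type} {i o o' m c : ι → Tree}

theorem size_le (h : Transforms i o) :
    ∃ q : Polynomial ℕ, ∀ a, (o a).size ≤ q.eval (i a).size := by
  obtain ⟨p, k, q, -, h⟩ := h
  refine ⟨q, fun a => ?_⟩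
  obtain ⟨s', t, -, -, -, -, h⟩ := h a (fun _ => i a) rfl
  exact h

theorem reindex (h : Transforms i o) (f : κ → ι) :
    Transforms (fun a => i (f a)) (fun a => o (f a)) := by
  obtain ⟨p, k, q, hk, h⟩ := h
  exact ⟨p, k, q, hk, fun a => h (f a)⟩

theorem id (i : ι → Tree) : Transforms i i := by
  refine ⟨.assign 0 (.var 0), 1, .X, one_pos, fun a s hs => ⟨_, _, .assign _ _ _, ?_, ?_, ?_, ?_⟩⟩
  · simp [Expr.eval, hs]
  · intro x hx; rw [Function.update_of_ne (by omega)]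
  · simp [Expr.cost, hs]
  · simp

theorem left (i : ι → Tree) : Transforms i fun a => (i a).left := by
  refine ⟨.assign 0 (.left (.var 0)), 1, .X + .X, one_pos,
    fun a s hs => ⟨_, _, .assign _ _ _, ?_, ?_, ?_, ?_⟩⟩
  · simp [Expr.eval, hs]
  · intro x hx; rw [Function.update_of_ne (by omega)]
  · simpa [Expr.cost, Expr.eval, hs] using (i a).size_left
  · simpa using le_add_right (i a).size_left

theorem right (i : ι → Tree) : Transforms i fun a => (i a).right := by
  refine ⟨.assign 0 (.right (.var 0)), 1, .X + .X, one_pos,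
    fun a s hs => ⟨_, _, .assign _ _ _, ?_, ?_, ?_, ?_⟩⟩
  · simp [Expr.eval, hs]
  · intro x hx; rw [Function.update_of_ne (by omega)]
  · simpa [Expr.cost, Expr.eval, hs] using (i a).size_right
  · simpa using le_add_right (i a).size_right

theorem nil (i : ι → Tree) : Transforms i fun _ => .nil := by
  refine ⟨.assign 0 .nil, 1, 1, one_pos, fun a s hs => ⟨_, _, .assign _ _ _, ?_, ?_, ?_, ?_⟩⟩
  · simp [Expr.eval]
  · intro x hx; rw [Function.update_of_ne (by omega)]
  · simp [Expr.cost]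
  · simp [Tree.size]

theorem trans (hg : Transforms i m) (hf : Transforms m o) : Transforms i o := by
  obtain ⟨p, k, q, hk, hf⟩ := hf
  obtain ⟨p', k', q', hk', hg⟩ := hg
  refine ⟨.seq p' p, max k k', q' + q.comp q', by omega, fun a s hs => ?_⟩
  obtain ⟨s₁, t₁, r₁, e₁, u₁, b₁, c₁⟩ := hg a s hs
  obtain ⟨s₂, t₂, r₂, e₂, u₂, b₂, c₂⟩ := hf a s₁ e₁
  have hm := eval_mono q c₁
  refine ⟨s₂, _, .seq r₁ r₂, e₂, fun x hx => ?_, ?_, ?_⟩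
  · rw [u₂ x (by omega), u₁ x (by omega)]
  · simp only [Polynomial.eval_add, Polynomial.eval_comp]; omega
  · simp only [Polynomial.eval_add, Polynomial.eval_comp]; omega

theorem cons (hf : Transforms i o) (hg : Transforms i o') :
    Transforms i fun a => .cons (o a) (o' a) := by
  obtain ⟨p, k, q, hk, hf⟩ := hf
  obtain ⟨p', k', q', hk', hg⟩ := hg
  -- Both programs preserve the variables `m` and `m + 1`: the first saves the input, the second the
  -- first result.
  obtain ⟨m, hm⟩ : ∃ m, m = max k k' := ⟨_, rfl⟩
  refine ⟨.seq (.assign m (.var 0)) (.seq p (.seq (.assign (m + 1) (.var 0))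
    (.seq (.assign 0 (.var m)) (.seq p' (.assign 0 (.cons (.var (m + 1)) (.var 0))))))), m + 2,
    2 * .X + 4 * q + 4 * q' + 1, by omega, fun a s hs => ?_⟩
  have h0 : Function.update s m (s 0) 0 = i a := by
    rw [Function.update_of_ne (by omega), hs]
  obtain ⟨s₁, t₁, r₁, e₁, u₁, b₁, c₁⟩ := hf a (Function.update s m (s 0)) h0
  have h1 : s₁ m = i a := by rw [u₁ m (by omega), Function.update_self, hs]
  obtain ⟨s₂, hs₂⟩ : ∃ s₂, s₂ = Function.update (Function.update s₁ (m + 1) (o a)) 0 (i a) :=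
    ⟨_, rfl⟩
  have h2 : s₂ 0 = i a := by rw [hs₂, Function.update_self]
  obtain ⟨s₃, t₃, r₃, e₃, u₃, b₃, c₃⟩ := hg a s₂ h2
  have h3 : s₃ (m + 1) = o a := by
    rw [u₃ _ (by omega), hs₂, Function.update_of_ne (by omega), Function.update_self]
  have ra₂ : Run (.assign (m + 1) (.var 0)) s₁ (Function.update s₁ (m + 1) (o a))
      (o a).size := by
    have := Run.assign (m + 1) (.var 0) s₁
    simpa [Expr.eval, Expr.cost, e₁] using this
  have ra₃ : Run (.assign 0 (.var m)) (Function.update s₁ (m + 1) (o a)) s₂ (i a).size := by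
    have := Run.assign 0 (.var m) (Function.update s₁ (m + 1) (o a))
    simp only [Expr.eval, Expr.cost] at this
    rwa [Function.update_of_ne (by omega), h1, ← hs₂] at this
  refine ⟨_, _, .seq (.assign _ _ _) (.seq r₁ (.seq ra₂ (.seq ra₃ (.seq r₃ (.assign _ _ _))))),
    ?_, fun x hx => ?_, ?_, ?_⟩
  · simp [Expr.eval, h3, e₃]
  · rw [Function.update_of_ne (by omega), u₃ x (by omega), hs₂, Function.update_of_ne (by omega),
      Function.update_of_ne (by omega), u₁ x (by omega), Function.update_of_ne (by omega)]
  · simp only [Expr.cost, Expr.eval, h3, e₃, hs, Tree.size, Polynomial.eval_add,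
      Polynomial.eval_mul, Polynomial.eval_X, Polynomial.eval_ofNat, Polynomial.eval_one]
    omega
  · simp only [Tree.size, Polynomial.eval_add, Polynomial.eval_mul,
      Polynomial.eval_X, Polynomial.eval_ofNat, Polynomial.eval_one]
    omega

theorem const (i : ι → Tree) : ∀ c : Tree, Transforms i fun _ => c
  | .nil => .nil i
  | .cons l r => (const i l).cons (const i r)

/-- Conditionals: each branch need only be correct on the arguments for which it is chosen. -/
theorem ite (hc : Transforms i c)
    (hf : Transforms (fun a : {a // c a ≠ .nil} => i a) (fun a => o a))
    (hg : Transforms (fun a : {a // c a = .nil} => i a) (fun a => o a)) : Transforms i o := by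
  -- The input is kept beside the value of the condition, and each branch starts by taking the right
  -- subtree to recover it.
  refine trans (m := fun a => .cons (c a) (i a)) (hc.cons (.id i)) ?_
  obtain ⟨p, k, q, hk, hf⟩ :=
    ((Transforms.right fun a : {a // c a ≠ .nil} => .cons (c a) (i a))).trans hf
  obtain ⟨p', k', q', hk', hg⟩ :=
    ((Transforms.right fun a : {a // c a = .nil} => .cons (c a) (i a))).trans hg
  refine ⟨.ite (.left (.var 0)) p p', max k k', 2 * .X + q + q', by omega, fun a s hs => ?_⟩
  have hl := (s 0).size_left
  by_cases h : c a = .nil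
  · obtain ⟨s₁, t₁, r₁, e₁, u₁, b₁, c₁⟩ := hg ⟨a, h⟩ s hs
    refine ⟨s₁, _, .ite_false (by simpa [Expr.eval, hs, Tree.left] using h) r₁, e₁,
      fun x hx => u₁ x (by omega), ?_, ?_⟩
    · simp only [Expr.cost, Expr.eval, Polynomial.eval_add, Polynomial.eval_mul,
        Polynomial.eval_X, Polynomial.eval_ofNat, hs] at hl b₁ ⊢
      omega
    · simp only [Polynomial.eval_add] at c₁ ⊢; omega
  · obtain ⟨s₁, t₁, r₁, e₁, u₁, b₁, c₁⟩ := hf ⟨a, h⟩ s hs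
    refine ⟨s₁, _, .ite_true (by simpa [Expr.eval, hs, Tree.left] using h) r₁, e₁,
      fun x hx => u₁ x (by omega), ?_, ?_⟩
    · simp only [Expr.cost, Expr.eval, Polynomial.eval_add, Polynomial.eval_mul,
        Polynomial.eval_X, Polynomial.eval_ofNat, hs] at hl b₁ ⊢
      omega
    · simp only [Polynomial.eval_add] at c₁ ⊢; omega

/-- While loops: the state is replaced by `b` of the state until the left subtree of its code is
`nil`. -/
theorem loop {σ : Type} {e : σ → Tree} {b : σ → σ} {init r : ι → σ}
    (hi : Transforms i fun a => e (init a)) (hb : Transforms e fun s => e (b s))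
    (q : Polynomial ℕ)
    (h : ∀ a, ∃ n ≤ q.eval (i a).size, (∀ j < n, (e (b^[j] (init a))).left ≠ .nil) ∧
      (e (b^[n] (init a))).left = .nil ∧
      (∀ j ≤ n, (e (b^[j] (init a))).size ≤ q.eval (i a).size) ∧ b^[n] (init a) = r a) :
    Transforms i fun a => e (r a) := by
  obtain ⟨p₀, k₀, q₀, hk₀, hi⟩ := hi
  obtain ⟨p, k, q', hk, hb⟩ := hb
  refine ⟨.seq p₀ (.loop (.left (.var 0)) p), max k₀ k,
    q₀ + q + (q + 1) * (2 * q + q'.comp q), by omega, fun a s hs => ?_⟩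
  obtain ⟨n, hn, h₁, h₂, h₃, h₄⟩ := h a
  set Q := q.eval (i a).size with hQ
  -- Induction on the number `j` of remaining rounds. Each evaluation of the guard costs at most `2
  -- * Q`, each execution of the body at most `q'.eval Q`.
  have key : ∀ j ≤ n, ∀ s₁ : Store, s₁ 0 = e (b^[n - j] (init a)) → ∃ s₂ t,
      Run (.loop (.left (.var 0)) p) s₁ s₂ t ∧ s₂ 0 = e (r a) ∧ (∀ x, k ≤ x → s₂ x = s₁ x) ∧
        t ≤ (j + 1) * (2 * Q + q'.eval Q) := by
    intro j
    induction j with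
    | zero =>
      intro _ s₁ hs
      simp only [Nat.sub_zero] at hs
      refine ⟨s₁, _, .loop_false (by simpa [Expr.eval, hs] using h₂), by rw [hs, h₄],
        fun _ _ => rfl, ?_⟩
      have := h₃ n le_rfl
      have hl := (s₁ 0).size_left
      simp only [Expr.cost, Expr.eval]
      rw [hs] at *
      omega
    | succ j ih =>
      intro hj s₁ hs
      obtain ⟨s₂, t₂, r₂, e₂, u₂, b₂, -⟩ := hb _ s₁ hs
      obtain ⟨s₃, t₃, r₃, e₃, u₃, b₃⟩ := ih (by omega) s₂ (by
        have : n - j = n - (j + 1) + 1 := by omega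
        rw [e₂, this, Function.iterate_succ_apply'])
      refine ⟨s₃, _, .loop_true (by simpa [Expr.eval, hs] using h₁ _ (by omega)) r₂ r₃, e₃,
        fun x hx => by rw [u₃ x hx, u₂ x hx], ?_⟩
      have hl := (s₁ 0).size_left
      have hb : (e (b^[n - (j + 1)] (init a))).size ≤ Q := h₃ _ (by omega)
      have := eval_mono q' hb
      simp only [Expr.cost, Expr.eval]
      rw [add_mul _ 1, one_mul]
      rw [hs] at *
      omega
  obtain ⟨s₁, t₁, r₁, e₁, u₁, b₁, c₁⟩ := hi a s hs
  obtain ⟨s₂, t, r, e₂, u, b⟩ := key n le_rfl s₁ (by simpa using e₁)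
  refine ⟨s₂, _, .seq r₁ r, e₂, fun x hx => by rw [u x (by omega), u₁ x (by omega)], ?_, ?_⟩
  · have := Nat.mul_le_mul_right (2 * Q + q'.eval Q) (Nat.add_le_add_right hn 1)
    simp only [Polynomial.eval_add, Polynomial.eval_mul, Polynomial.eval_ofNat, Polynomial.eval_one,
      Polynomial.eval_comp, ← hQ]
    omega
  · have := h₃ n le_rfl
    rw [h₄] at this
    simp only [Polynomial.eval_add, ← hQ]
    omega

end Transforms

end DefeasibleEL

namespace DefeasibleEL

/-! ## Encodings and polynomial-time functions between encoded types -/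

/-- Types whose elements are coded injectively as trees. -/
class Enc (α : Type) where
  enc : α → Tree
  inj : Function.Injective enc

open Enc (enc)

instance : Enc Tree := ⟨fun t => t, fun _ _ h => h⟩

theorem encodeBit_injective : Function.Injective encodeBit := by
  intro a b; cases a <;> cases b <;> simp [encodeBit]

instance : Enc Bool := ⟨encodeBit, encodeBit_injective⟩

theorem encodeList_injective {α : Type} {e : α → Tree} (he : Function.Injective e) :
    Function.Injective (encodeList e) := by
  intro l
  induction l with
  | nil => intro l'; cases l' <;> simp [encodeList]
  | cons a l ih =>
    intro l'
    cases l' with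
    | nil => simp [encodeList]
    | cons b l' =>
      simp only [encodeList, Tree.cons.injEq, List.cons.injEq, and_imp]
      exact fun h h' => ⟨he h, ih h'⟩

instance {α : Type} [Enc α] : Enc (List α) := ⟨encodeList enc, encodeList_injective Enc.inj⟩

theorem bits_injective : Function.Injective Nat.bits := by
  intro m
  induction m using Nat.strong_induction_on with
  | _ m ih =>
    intro n h
    have hb : m.bodd = n.bodd := by rw [Nat.bodd_eq_bits_head, h, Nat.bodd_eq_bits_head]
    have hd : m.div2.bits = n.div2.bits := by
      rw [Nat.div2_bits_eq_tail, h, Nat.div2_bits_eq_tail]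
    rcases Nat.eq_zero_or_pos m with rfl | hm
    · have := congrArg List.length h
      rw [Nat.size_eq_bits_len, Nat.size_eq_bits_len, Nat.size_zero] at this
      exact (Nat.size_eq_zero.1 this.symm).symm
    · rw [← Nat.bit_bodd_div2 m, ← Nat.bit_bodd_div2 n, hb,
        ih m.div2 (by rw [Nat.div2_val]; omega) hd]

theorem encodeName_injective : Function.Injective encodeName := fun _ _ h =>
  bits_injective (encodeList_injective encodeBit_injective h)

instance : Enc ℕ := ⟨encodeName, encodeName_injective⟩

instance {α β : Type} [Enc α] [Enc β] : Enc (α × β) :=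
  ⟨fun p => .cons (enc p.1) (enc p.2), fun p p' h => by
    simp only [Tree.cons.injEq] at h
    exact Prod.ext (Enc.inj h.1) (Enc.inj h.2)⟩

/-- The code of an optional value. -/
def encodeOption {α : Type} (e : α → Tree) : Option α → Tree
  | none => .nil
  | some a => .cons (e a) .nil

instance {α : Type} [Enc α] : Enc (Option α) := ⟨encodeOption enc, fun a b h => by
  cases a <;> cases b <;> simp_all [encodeOption]
  exact Enc.inj h⟩

theorem encodeEL_injective : Function.Injective encodeEL := by
  intro C
  induction C with
  | atom A =>
    intro D h
    cases D <;> simp only [encodeEL, encodeTag, Tree.cons.injEq, reduceCtorEq, false_and,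
      and_false, true_and] at h ⊢
    rw [encodeName_injective h]
  | top => intro D h; cases D <;> simp_all [encodeEL, encodeTag]
  | bot => intro D h; cases D <;> simp_all [encodeEL, encodeTag]
  | inf C C' ih ih' =>
    intro D h
    cases D <;> simp only [encodeEL, encodeTag, Tree.cons.injEq, reduceCtorEq, false_and,
      and_false, true_and] at h ⊢
    rw [ih h.1, ih' h.2]
  | ex r C ih =>
    intro D h
    cases D <;> simp only [encodeEL, encodeTag, Tree.cons.injEq, reduceCtorEq, false_and,
      and_false, true_and] at h ⊢
    rw [encodeName_injective h.1, ih h.2]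

instance : Enc EL := ⟨encodeEL, encodeEL_injective⟩

instance : Enc GCI := ⟨encodeGCI, fun g g' h => by
  cases g; cases g'
  simp only [encodeGCI, Tree.cons.injEq] at h
  simp [encodeEL_injective h.1, encodeEL_injective h.2]⟩

instance : Enc DGCI := ⟨encodeDGCI, fun g g' h => by
  cases g; cases g'
  simp only [encodeDGCI, Tree.cons.injEq] at h
  simp [encodeEL_injective h.1, encodeEL_injective h.2]⟩

instance : Enc KB := ⟨encodeKB, fun K K' h => by
  cases K; cases K'
  simp only [encodeKB, Tree.cons.injEq] at h
  have h₁ := Enc.inj (α := TBox) h.1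
  have h₂ := Enc.inj (α := DBox) h.2
  simp_all⟩

instance : Enc Ranking := ⟨encodeRanking, fun R R' h => by
  cases R; cases R'
  simp only [encodeRanking, Tree.cons.injEq] at h
  have h₁ := Enc.inj (α := TBox) h.1
  have h₂ := Enc.inj (α := DBox) h.2.1
  have h₃ := Enc.inj (α := List DBox) h.2.2
  simp_all⟩

/-! ### Sizes of codes and polynomial bounds -/

/-- The size of the code of an element. -/
def esize {α : Type} [Enc α] (a : α) : ℕ := (enc a).size

section
variable {α β γ σ : Type} [Enc α] [Enc β] [Enc γ] [Enc σ]

theorem esize_pos (a : α) : 1 ≤ esize a := Tree.size_pos _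

@[simp] theorem esize_nil : esize ([] : List α) = 1 := rfl

@[simp] theorem esize_cons (a : α) (l : List α) : esize (a :: l) = esize a + esize l + 1 := rfl

@[simp] theorem esize_prod (p : α × β) : esize p = esize p.1 + esize p.2 + 1 := rfl

theorem esize_bool (b : Bool) : esize b ≤ 3 := by
  cases b <;> simp [esize, enc, encodeBit, Tree.size]

theorem esize_append (l l' : List α) : esize (l ++ l') + 1 = esize l + esize l' := by
  induction l with
  | nil => simp [add_comm]
  | cons a l ih => simp only [List.cons_append, esize_cons]; omega

theorem esize_reverse (l : List α) : esize l.reverse = esize l := by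
  induction l with
  | nil => rfl
  | cons a l ih =>
    have := esize_append l.reverse [a]
    simp at this ⊢; omega

theorem esize_sublist {l l' : List α} (h : l.Sublist l') : esize l ≤ esize l' := by
  induction h with
  | slnil => rfl
  | cons a _ ih => simp; omega
  | cons_cons a _ ih => simp; omega

theorem esize_mem {l : List α} {a : α} (h : a ∈ l) : esize a < esize l := by
  induction l with
  | nil => simp at h
  | cons b l ih =>
    rcases List.mem_cons.1 h with rfl | h
    · simp only [esize_cons]; omega
    · have := ih h; simp; omega

theorem length_lt_esize (l : List α) : l.length < esize l := by
  induction l with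
  | nil => simp
  | cons b l ih => simp; omega

theorem esize_le_of_forall {l : List α} {N : ℕ} (h : ∀ a ∈ l, esize a ≤ N) :
    esize l ≤ l.length * (N + 1) + 1 := by
  induction l with
  | nil => simp
  | cons b l ih =>
    have := ih fun a ha => h a (by simp [ha])
    have := h b (by simp)
    simp [add_mul]; omega

/-- Natural-number functions that are bounded by a polynomial in the size of the argument. -/
def PolyBdd (h : α → ℕ) : Prop := ∃ q : Polynomial ℕ, ∀ a, h a ≤ q.eval (esize a)

theorem PolyBdd.const (n : ℕ) : PolyBdd fun _ : α => n := ⟨.C n, fun a => by simp⟩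

theorem PolyBdd.esize : PolyBdd fun a : α => esize a := ⟨.X, fun a => by simp⟩

theorem PolyBdd.add {f g : α → ℕ} (hf : PolyBdd f) (hg : PolyBdd g) :
    PolyBdd fun a => f a + g a := by
  obtain ⟨q, hq⟩ := hf
  obtain ⟨q', hq'⟩ := hg
  exact ⟨q + q', fun a => by simpa using Nat.add_le_add (hq a) (hq' a)⟩

theorem PolyBdd.mul {f g : α → ℕ} (hf : PolyBdd f) (hg : PolyBdd g) :
    PolyBdd fun a => f a * g a := by
  obtain ⟨q, hq⟩ := hf
  obtain ⟨q', hq'⟩ := hg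
  exact ⟨q * q', fun a => by simpa using Nat.mul_le_mul (hq a) (hq' a)⟩

theorem PolyBdd.eval {f : α → ℕ} (hf : PolyBdd f) (p : Polynomial ℕ) :
    PolyBdd fun a => p.eval (f a) := by
  obtain ⟨q, hq⟩ := hf
  exact ⟨p.comp q, fun a => by simpa using eval_mono p (hq a)⟩

/-! ### Closure properties of polynomial-time functions -/

/-- Functions between encoded types that are computable in polynomial time. -/
@[fun_prop]
def Poly (f : α → β) : Prop := Transforms enc fun a => enc (f a)

theorem Poly.congr {f g : α → β} (hf : Poly f) (h : ∀ a, f a = g a) : Poly g :=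
  (funext h : f = g) ▸ hf

theorem Poly.esize_le {f : α → β} (hf : Poly f) : PolyBdd fun a => esize (f a) :=
  Transforms.size_le hf

@[fun_prop]
theorem Poly.id : Poly fun a : α => a := Transforms.id _

@[fun_prop]
theorem Poly.const (b : β) : Poly fun _ : α => b := Transforms.const _ _

@[fun_prop]
theorem Poly.comp {f : β → γ} {g : α → β} (hf : Poly f) (hg : Poly g) :
    Poly fun a => f (g a) := Transforms.trans hg (Transforms.reindex hf g)

@[fun_prop]
theorem Poly.prodMk {f : α → β} {g : α → γ} (hf : Poly f) (hg : Poly g) :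
    Poly fun a => (f a, g a) := Transforms.cons hf hg

@[fun_prop]
theorem Poly.fst : Poly (Prod.fst : α × β → α) := Transforms.left _

@[fun_prop]
theorem Poly.snd : Poly (Prod.snd : α × β → β) := Transforms.right _

@[fun_prop]
theorem Poly.listCons {f : α → β} {g : α → List β} (hf : Poly f) (hg : Poly g) :
    Poly fun a => f a :: g a := Transforms.cons hf hg

@[fun_prop]
theorem Poly.optionSome {f : α → β} (hf : Poly f) : Poly fun a => Option.some (f a) :=
  Transforms.cons hf (.nil _)

@[fun_prop]
theorem Poly.ite {c : α → Bool} {f g : α → β} (hc : Poly c) (hf : Poly f) (hg : Poly g) :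
    Poly fun a => if c a = true then f a else g a := by
  have key : ∀ b, enc b = .nil ↔ b = false := by intro b; cases b <;> simp [enc, encodeBit]
  refine Transforms.ite hc ?_ ?_
  · convert Transforms.reindex hf fun a : {a // enc (c a) ≠ .nil} => a.1 using 2 with a
    have := a.2
    simp [key] at this
    simp [this]
  · convert Transforms.reindex hg fun a : {a // enc (c a) = .nil} => a.1 using 2 with a
    have := a.2
    simp [key] at this
    simp [this]

@[fun_prop]
theorem Poly.and {f g : α → Bool} (hf : Poly f) (hg : Poly g) : Poly fun a => f a && g a :=
  (hf.ite hg (.const false)).congr fun a => by cases f a <;> simp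

@[fun_prop]
theorem Poly.or {f g : α → Bool} (hf : Poly f) (hg : Poly g) : Poly fun a => f a || g a :=
  (hf.ite (.const true) hg).congr fun a => by cases f a <;> simp

@[fun_prop]
theorem Poly.not {f : α → Bool} (hf : Poly f) : Poly fun a => !(f a) :=
  (hf.ite (.const false) (.const true)).congr fun a => by cases f a <;> simp

/-- A nonempty list `x :: xs` and the pair `(x, xs)` have the same code, so in the nonempty case
pairing the argument with the list already yields the code of `(a, x, xs)`. -/
theorem Poly.listCases {l : α → List β} {n : α → γ} {k : α × β × List β → γ} (hl : Poly l)
    (hn : Poly n) (hk : Poly k) :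
    Poly fun a => match l a with | [] => n a | x :: xs => k (a, x, xs) := by
  refine Transforms.ite hl ?_ ?_
  · refine Transforms.trans (m := fun a => .cons (enc a.1) (enc (l a))) ?_ ?_
    · exact Transforms.cons (.id _) (Transforms.reindex hl Subtype.val)
    · have key : ∀ a : {a // enc (l a) ≠ .nil}, ∃ x xs, l a = x :: xs := by
        rintro ⟨a, ha⟩
        match h : l a with
        | [] => exact absurd (congrArg enc h) ha
        | x :: xs => exact ⟨x, xs, rfl⟩
      choose x xs hx using key
      convert Transforms.reindex hk fun a => (a.1, x a, xs a) using 2 with a a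
      · simp only [hx]; rfl
      · simp only [hx]
  · convert Transforms.reindex hn fun a : {a // enc (l a) = .nil} => a.1 using 2 with a
    have : l a = [] := Enc.inj (a₁ := l a) (a₂ := []) a.2
    simp [this]

@[fun_prop]
theorem Poly.treeLeft : Poly Tree.left := Transforms.left _

@[fun_prop]
theorem Poly.treeRight : Poly Tree.right := Transforms.right _

/-- The test for the empty tree. -/
def Tree.isNil : Tree → Bool
  | .nil => true
  | .cons _ _ => false

@[fun_prop]
theorem Poly.treeIsNil : Poly Tree.isNil := by
  refine Transforms.ite (.id _) ?_ ?_
  · convert Transforms.const _ (enc false) using 2 with t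
    obtain ⟨_ | _, ht⟩ := t
    · exact absurd rfl ht
    · rfl
  · convert Transforms.const _ (enc true) using 2 with t
    rw [show t.1 = Tree.nil from t.2]; rfl

@[fun_prop]
theorem Poly.optionElim {l : α → Option β} {n : α → γ} {k : α → β → γ} (hl : Poly l)
    (hn : Poly n) (hk : Poly fun p : α × β => k p.1 p.2) :
    Poly fun a => (l a).elim (n a) (k a) := by
  refine Transforms.ite hl ?_ ?_
  · refine Transforms.trans (m := fun a => .cons (enc a.1) (enc (l a)).left) ?_ ?_
    · exact Transforms.cons (.id _)
        (Transforms.trans (Transforms.reindex hl Subtype.val) (Transforms.left _))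
    · have key : ∀ a : {a // enc (l a) ≠ .nil}, ∃ x, l a = some x := by
        rintro ⟨a, ha⟩
        match h : l a with
        | none => exact absurd (congrArg enc h) ha
        | some x => exact ⟨x, rfl⟩
      choose x hx using key
      convert Transforms.reindex hk fun a => (a.1, x a) using 2 with a a
      · simp only [hx]; rfl
      · simp only [hx, Option.elim_some]
  · convert Transforms.reindex hn fun a : {a // enc (l a) = .nil} => a.1 using 2 with a
    have : l a = none := Enc.inj (a₁ := l a) (a₂ := none) a.2
    simp [this]

/-- While loops. The state `s` is replaced by `b s` as long as `c s` holds; `f` is the final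
state. -/
theorem Poly.loop {c : σ → Bool} {b : σ → σ} {init : α → σ} (hc : Poly c) (hb : Poly b)
    (hi : Poly init) (f : σ → σ) (hf₀ : ∀ s, c s = false → f s = s)
    (hf₁ : ∀ s, c s = true → f (b s) = f s) (Inv : α → σ → Prop) (μ : σ → ℕ) {B : α → ℕ}
    (hB : PolyBdd B) (h₀ : ∀ a, Inv a (init a))
    (h₁ : ∀ a s, Inv a s → c s = true → Inv a (b s) ∧ μ (b s) < μ s)
    (h₂ : ∀ a s, Inv a s → esize s ≤ B a ∧ μ s ≤ B a) :
    Poly fun a => f (init a) := by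
  obtain ⟨q, hq⟩ := hB
  have key : ∀ N a s, Inv a s → μ s ≤ N → ∃ n ≤ N, (∀ i < n, c (b^[i] s) = true) ∧
      c (b^[n] s) = false ∧ (∀ i ≤ n, Inv a (b^[i] s)) ∧ b^[n] s = f s := by
    intro N
    induction N with
    | zero =>
      intro a s hs hμ
      have hcs : c s = false := by
        by_contra h
        have := (h₁ a s hs (by simpa using h)).2
        omega
      exact ⟨0, le_rfl, by simp, hcs, by simpa using hs, (hf₀ s hcs).symm⟩
    | succ N ih =>
      intro a s hs hμ
      by_cases hcs : c s = true
      · obtain ⟨h, h'⟩ := h₁ a s hs hcs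
        obtain ⟨n, hn, k₁, k₂, k₃, k₄⟩ := ih a (b s) h (by omega)
        refine ⟨n + 1, by omega, ?_, k₂, ?_, k₄.trans (hf₁ s hcs)⟩
        · rintro (_ | i) hi
          · exact hcs
          · exact k₁ i (by omega)
        · rintro (_ | i) hi
          · exact hs
          · exact k₃ i (by omega)
      · have hcs : c s = false := by simpa using hcs
        exact ⟨0, by omega, by simp, hcs, by simpa using hs, (hf₀ s hcs).symm⟩
  -- `Transforms.loop` inspects the left subtree, so the state travels with its guard bit, which is
  -- recomputed after every round. The bit and the additional node account for the `4` in the bound.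
  have hinit : Transforms enc fun a => .cons (enc (c (init a))) (enc (init a)) :=
    Transforms.cons (hc.comp hi) hi
  have hbody : Transforms (fun s : σ => .cons (enc (c s)) (enc s))
      (fun s : σ => .cons (enc (c (b s))) (enc (b s))) :=
    (Transforms.right _).trans (Transforms.cons (hc.comp hb) hb)
  refine Transforms.trans (Transforms.loop (r := fun a => f (init a)) hinit hbody
    (q + 4) fun a => ?_) (Transforms.right _)
  obtain ⟨n, hn, k₁, k₂, k₃, k₄⟩ := key _ a (init a) (h₀ a) le_rfl
  have hqa := hq a
  have h2 := (h₂ a _ (h₀ a)).2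
  simp only [esize] at hqa
  refine ⟨n, ?_, fun j hj => ?_, ?_, fun j hj => ?_, k₄⟩
  · simp only [Polynomial.eval_add]; omega
  · simp [k₁ j hj, Tree.left, enc, encodeBit]
  · simp [k₂, Tree.left, enc, encodeBit]
  · have := (h₂ a _ (k₃ j hj)).1
    have := esize_bool (c (b^[j] (init a)))
    simp only [esize] at *
    simp only [Tree.size, Polynomial.eval_add, Polynomial.eval_ofNat]; omega

end

end DefeasibleEL

namespace DefeasibleEL
open Enc (enc)

/-! ### Polynomial-time operations on lists, and equality tests -/

section
variable {α β γ σ : Type} [Enc α] [Enc β] [Enc γ] [Enc σ]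

@[fun_prop]
theorem Poly.isEmpty {l : α → List β} (hl : Poly l) : Poly fun a => (l a).isEmpty :=
  (hl.listCases (.const true) (k := fun _ => false) (.const false)).congr fun a => by
    cases l a <;> rfl

/-- The loop state consists of the unread part of the list, the argument and the accumulator. The
bound on the accumulator after every prefix cannot be dropped: iterating a polynomial-time step may
produce exponentially large values. -/
theorem Poly.foldl {l : α → List γ} {init : α → β} {step : α → β → γ → β} (hl : Poly l)
    (hi : Poly init) (hs : Poly fun p : α × β × γ => step p.1 p.2.1 p.2.2) {B : α → ℕ}
    (hB : PolyBdd B) (h : ∀ a l', l' <+: l a → esize (l'.foldl (step a) (init a)) ≤ B a) :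
    Poly fun a => (l a).foldl (step a) (init a) := by
  let c : List γ × α × β → Bool := fun s => !s.1.isEmpty
  let b : List γ × α × β → List γ × α × β := fun s => match s.1 with
    | [] => s
    | x :: xs => (xs, s.2.1, step s.2.1 s.2.2 x)
  have hb : Poly b := Poly.listCases .fst .id
    (k := fun q => (q.2.2, q.1.2.1, step q.1.2.1 q.1.2.2 q.2.1)) (by
      have h1 : Poly fun q : (List γ × α × β) × γ × List γ => step q.1.2.1 q.1.2.2 q.2.1 :=
        hs.comp (g := fun q : (List γ × α × β) × γ × List γ => (q.1.2.1, q.1.2.2, q.2.1))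
          (by fun_prop)
      fun_prop)
  have hinit : Poly fun a => (l a, a, init a) := by fun_prop
  have hc : Poly c := by fun_prop
  have key := Poly.loop hc hb hinit (fun s => ([], s.2.1, s.1.foldl (step s.2.1) s.2.2))
    (by rintro ⟨_ | ⟨x, l⟩, a, y⟩ hs <;> simp_all [c])
    (by rintro ⟨_ | ⟨x, l⟩, a, y⟩ hs <;> simp_all [c, b])
    (fun a s => s.2.1 = a ∧ ∃ l', l a = l' ++ s.1 ∧ s.2.2 = l'.foldl (step a) (init a))
    (fun s => s.1.length)
    ((hl.esize_le.add (PolyBdd.esize.add hB)).add (.const 2))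
    (fun a => ⟨rfl, [], rfl, rfl⟩) ?_ ?_
  · exact Poly.snd.comp (Poly.snd.comp key)
  · rintro a ⟨_ | ⟨x, xs⟩, a', y⟩ ⟨rfl, l', h₁, h₂⟩ hcs
    · simp [c] at hcs
    · refine ⟨⟨rfl, l' ++ [x], by simpa using h₁, ?_⟩, by simp [b]⟩
      simp only at h₂
      simp [b, h₂]
  · rintro a ⟨xs, a', y⟩ ⟨rfl, l', h₁, h₂⟩
    have hy := h a' l' ⟨xs, h₁.symm⟩
    simp only at h₂ h₁
    rw [← h₂] at hy
    have := esize_sublist (show xs.Sublist (l a') by rw [h₁]; exact List.sublist_append_right _ _)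
    have := length_lt_esize xs
    simp only [esize_prod]
    omega

@[fun_prop]
theorem Poly.reverse {l : α → List β} (hl : Poly l) : Poly fun a => (l a).reverse := by
  have key : ∀ l : List β, l.foldl (fun acc x => x :: acc) [] = l.reverse := by simp
  refine (Poly.foldl (step := fun _ acc x => x :: acc) hl (.const []) (by fun_prop) hl.esize_le
    fun a l' hl' => ?_).congr fun a => key _
  rw [key, esize_reverse]
  exact esize_sublist hl'.sublist

@[fun_prop]
theorem Poly.append {l l' : α → List β} (hl : Poly l) (hl' : Poly l') :
    Poly fun a => l a ++ l' a := by
  have key : ∀ l l' : List β, l.foldl (fun acc x => x :: acc) l' = l.reverse ++ l' := by simp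
  refine (Poly.foldl (step := fun _ acc x => x :: acc) hl.reverse hl' (by fun_prop)
    (hl.esize_le.add hl'.esize_le) fun a m hm => ?_).congr fun a => by simp
  rw [key]
  have := esize_append m.reverse (l' a)
  have := esize_sublist hm.sublist
  rw [esize_reverse] at *
  omega

omit [Enc β] in
theorem esize_flatMap_le {l : List β} {g : β → List γ} {N : ℕ} (h : ∀ x ∈ l, esize (g x) ≤ N) :
    esize (l.flatMap g) ≤ l.length * N + 1 := by
  induction l with
  | nil => simp
  | cons x l ih =>
    have := ih fun y hy => h y (by simp [hy])
    have := h x (by simp)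
    have := esize_append (g x) (l.flatMap g)
    simp only [List.flatMap_cons, List.length_cons, add_mul, one_mul]
    omega

@[fun_prop]
theorem Poly.flatMap {l : α → List β} {g : α → β → List γ} (hl : Poly l)
    (hg : Poly fun p : α × β => g p.1 p.2) : Poly fun a => (l a).flatMap (g a) := by
  have key : ∀ (g : β → List γ) (l : List β) (acc : List γ),
      l.foldl (fun acc x => acc ++ g x) acc = acc ++ l.flatMap g := by
    intro g l
    induction l with
    | nil => simp
    | cons x l ih => intro acc; simp [ih]
  obtain ⟨q, hq⟩ := hg.esize_le
  refine (Poly.foldl (step := fun a acc x => acc ++ g a x) hl (.const []) ?_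
    (((hl.esize_le).mul ((PolyBdd.esize.add (hl.esize_le.add (.const 1))).eval q)).add (.const 1))
    fun a l' hl' => ?_).congr fun a => by rw [key]; rfl
  · have : Poly fun p : α × List γ × β => g p.1 p.2.2 :=
      hg.comp (g := fun p : α × List γ × β => (p.1, p.2.2)) (by fun_prop)
    fun_prop
  · rw [key, List.nil_append]
    refine (esize_flatMap_le (N := q.eval (esize a + (esize (l a) + 1))) fun x hx => ?_).trans ?_
    · refine (hq (a, x)).trans (eval_mono q ?_)
      have := esize_mem (hl'.subset hx)
      simp only [esize_prod]; omega
    · have := length_lt_esize l'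
      have := esize_sublist hl'.sublist
      gcongr
      omega

@[fun_prop]
theorem Poly.map {l : α → List β} {g : α → β → γ} (hl : Poly l)
    (hg : Poly fun p : α × β => g p.1 p.2) : Poly fun a => (l a).map (g a) :=
  (hl.flatMap (g := fun a x => [g a x]) (by fun_prop)).congr fun a => by
    rw [List.map_eq_flatMap]

@[fun_prop]
theorem Poly.filter {l : α → List β} {g : α → β → Bool} (hl : Poly l)
    (hg : Poly fun p : α × β => g p.1 p.2) : Poly fun a => (l a).filter (g a) :=
  (hl.flatMap (g := fun a x => if g a x = true then [x] else []) (by fun_prop)).congr fun a => by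
    induction l a with
    | nil => rfl
    | cons x l ih => by_cases h : g a x = true <;> simp_all

@[fun_prop]
theorem Poly.any {l : α → List β} {g : α → β → Bool} (hl : Poly l)
    (hg : Poly fun p : α × β => g p.1 p.2) : Poly fun a => (l a).any (g a) :=
  (hl.filter hg).isEmpty.not.congr fun a => by
    rw [Bool.eq_iff_iff]
    simp

/-- Recursion on trees becomes a worklist of pairs still to be compared. Splitting a pair of inner
nodes leaves the size of the worklist unchanged and lowers the sum of the sizes of its pairs, which
serves as the measure. -/
theorem Poly.treeEq : Poly fun p : Tree × Tree => decide (p.1 = p.2) := by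
  let c : List (Tree × Tree) × Bool → Bool := fun s => !s.1.isEmpty
  let k : (List (Tree × Tree) × Bool) × (Tree × Tree) × List (Tree × Tree) →
      List (Tree × Tree) × Bool := fun q =>
    if q.2.1.1.isNil = true then (q.2.2, q.1.2 && q.2.1.2.isNil)
    else if q.2.1.2.isNil = true then (q.2.2, false)
    else ((q.2.1.1.left, q.2.1.2.left) :: (q.2.1.1.right, q.2.1.2.right) :: q.2.2, q.1.2)
  let b : List (Tree × Tree) × Bool → List (Tree × Tree) × Bool := fun s => match s.1 with
    | [] => s
    | p :: w => k (s, p, w)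
  have hk : Poly k := by fun_prop
  have hb : Poly b := (Poly.listCases .fst .id hk).congr fun s => by
    rcases s with ⟨_ | _, _⟩ <;> rfl
  have hc : Poly c := by fun_prop
  have hinit : Poly fun p : Tree × Tree => ([p], true) := by fun_prop
  have key := Poly.loop hc hb hinit (fun s => ([], s.2 && s.1.all fun p => decide (p.1 = p.2)))
    (by rintro ⟨_ | ⟨x, l⟩, y⟩ hs <;> simp_all [c])
    (by
      rintro ⟨_ | ⟨⟨_ | ⟨l, r⟩, _ | ⟨l', r'⟩⟩, w⟩, y⟩ hs <;>
        simp_all [c, b, k, Bool.and_assoc, Tree.isNil, Tree.left, Tree.right])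
    (fun a s => esize s.1 ≤ esize [a])
    (fun s => (s.1.map fun p => esize p.1).sum)
    ((PolyBdd.esize).add (.const 6))
    (fun a => le_rfl) ?_ ?_
  · exact (Poly.snd.comp key).congr fun p => by simp
  · rintro a ⟨_ | ⟨⟨_ | ⟨l, r⟩, _ | ⟨l', r'⟩⟩, w⟩, y⟩ ha hcs <;>
      simp [c, b, k, esize, enc, Tree.size, encodeList, Tree.isNil, Tree.left, Tree.right] at ha hcs ⊢ <;> omega
  · rintro a ⟨w, y⟩ ha
    have : (w.map fun p => esize p.1).sum ≤ esize w := by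
      clear ha
      induction w with
      | nil => simp
      | cons x w ih => simp; omega
    have := esize_bool y
    simp only [esize_prod, esize_cons, esize_nil] at ha ⊢
    omega

@[fun_prop]
theorem Poly.eq [DecidableEq β] {f g : α → β} (hf : Poly f) (hg : Poly g) :
    Poly fun a => decide (f a = g a) := by
  have h : Poly fun a => decide (enc (f a) = enc (g a)) :=
    Poly.treeEq.comp (g := fun a => (enc (f a), enc (g a))) (Poly.prodMk hf hg)
  exact h.congr fun a => by simp [Enc.inj.eq_iff]

@[fun_prop]
theorem Poly.mem {f : α → β} {l : α → List β} {_ : ∀ a, Decidable (f a ∈ l a)} (hf : Poly f)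
    (hl : Poly l) : Poly fun a => decide (f a ∈ l a) := by
  classical
  exact (hl.any (g := fun a x => decide (x = f a)) (by fun_prop)).congr fun a => by
    rw [Bool.eq_iff_iff]
    simp

/-! ### Constructors and destructors of concepts, axioms and knowledge bases -/

@[fun_prop]
theorem Poly.ex {f : α → ℕ} {g : α → EL} (hf : Poly f) (hg : Poly g) :
    Poly fun a => EL.ex (f a) (g a) :=
  Transforms.cons (.const _ _) (Transforms.cons hf hg)

@[fun_prop]
theorem Poly.gci {f g : α → EL} (hf : Poly f) (hg : Poly g) : Poly fun a => GCI.mk (f a) (g a) :=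
  Transforms.cons hf hg

@[fun_prop]
theorem Poly.gciLhs : Poly GCI.lhs := Transforms.left _

@[fun_prop]
theorem Poly.gciRhs : Poly GCI.rhs := Transforms.right _

@[fun_prop]
theorem Poly.dgciLhs : Poly DGCI.lhs := Transforms.left _

@[fun_prop]
theorem Poly.dgciRhs : Poly DGCI.rhs := Transforms.right _

@[fun_prop]
theorem Poly.kbTbox : Poly KB.tbox := Transforms.left _

@[fun_prop]
theorem Poly.kbDbox : Poly KB.dbox := Transforms.right _

@[fun_prop]
theorem Poly.ranking {f : α → TBox} {g : α → DBox} {h : α → List DBox} (hf : Poly f) (hg : Poly g)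
    (hh : Poly h) : Poly fun a => Ranking.mk (f a) (g a) (h a) :=
  Transforms.cons hf (Transforms.cons hg hh)

/-- The role and the filler of an existential restriction. -/
def EL.unEx : EL → Option (ℕ × EL)
  | .ex r C => some (r, C)
  | _ => none

/-- The two members of a conjunction. -/
def EL.unInf : EL → Option (EL × EL)
  | .inf C D => some (C, D)
  | _ => none

theorem transforms_hasTag (n : ℕ) :
    Transforms (enc : EL → Tree) fun C => enc (decide ((encodeEL C).left = encodeTag n)) :=
  (Poly.treeEq.comp (g := fun t : Tree => (t.left, encodeTag n))
    (Transforms.cons (Transforms.left _) (.const _ _))).reindex encodeEL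

@[fun_prop]
theorem Poly.unEx : Poly EL.unEx := by
  have key : ∀ C : EL, enc (decide ((encodeEL C).left = encodeTag 4)) = .nil ↔ C.unEx = none := by
    intro C; cases C <;> simp [encodeEL, Tree.left, encodeTag, enc, encodeBit, EL.unEx]
  refine Transforms.ite (transforms_hasTag 4) ?_ ?_
  · convert Transforms.cons (Transforms.right _) (Transforms.nil _) using 2 with C
    obtain ⟨C, hC⟩ := C
    rw [ne_eq, key] at hC
    cases C <;> simp_all [EL.unEx]
    rfl
  · convert Transforms.nil _ using 2 with C
    obtain ⟨C, hC⟩ := C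
    rw [key] at hC
    simp only [hC]; rfl

@[fun_prop]
theorem Poly.unInf : Poly EL.unInf := by
  have key : ∀ C : EL, enc (decide ((encodeEL C).left = encodeTag 3)) = .nil ↔
      C.unInf = none := by
    intro C; cases C <;> simp [encodeEL, Tree.left, encodeTag, enc, encodeBit, EL.unInf]
  refine Transforms.ite (transforms_hasTag 3) ?_ ?_
  · convert Transforms.cons (Transforms.right _) (Transforms.nil _) using 2 with C
    obtain ⟨C, hC⟩ := C
    rw [ne_eq, key] at hC
    cases C <;> simp_all [EL.unInf]
    rfl
  · convert Transforms.nil _ using 2 with C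
    obtain ⟨C, hC⟩ := C
    rw [key] at hC
    simp only [hC]; rfl

end

end DefeasibleEL

namespace DefeasibleEL
open Enc (enc)

/-! ## Subconcepts -/

/-- The immediate subconcepts. -/
def EL.children : EL → List EL
  | .inf C D => [C, D]
  | .ex _ C => [C]
  | _ => []

/-- The subconcepts, with repetitions. -/
def EL.subs : EL → List EL
  | .inf C D => .inf C D :: (C.subs ++ D.subs)
  | .ex r C => .ex r C :: C.subs
  | .atom A => [.atom A]
  | .top => [.top]
  | .bot => [.bot]

theorem EL.subs_eq (C : EL) : C.subs = C :: C.children.flatMap EL.subs := by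
  cases C <;> simp [subs, children]

theorem EL.mem_subs_self (C : EL) : C ∈ C.subs := by rw [subs_eq]; simp

theorem EL.subs_trans {C D E : EL} (h : D ∈ C.subs) (h' : E ∈ D.subs) : E ∈ C.subs := by
  induction C with
  | atom A => simp only [subs, List.mem_singleton] at h; subst h; exact h'
  | top => simp only [subs, List.mem_singleton] at h; subst h; exact h'
  | bot => simp only [subs, List.mem_singleton] at h; subst h; exact h'
  | inf C C' ih ih' =>
    simp only [subs, List.mem_cons, List.mem_append] at h ⊢
    rcases h with rfl | h | h
    · simpa [subs] using h'
    · exact .inr (.inl (ih h))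
    · exact .inr (.inr (ih' h))
  | ex r C ih =>
    simp only [subs, List.mem_cons] at h ⊢
    rcases h with rfl | h
    · simpa [subs] using h'
    · exact .inr (ih h)

@[fun_prop]
theorem poly_children : Poly EL.children := by
  have h : Poly fun C : EL =>
      C.unInf.elim (C.unEx.elim [] fun p => [p.2]) fun p => [p.1, p.2] := by fun_prop
  exact h.congr fun C => by cases C <;> rfl

/-- The sum of squared sizes is the potential of the traversal in `poly_flatMap_subs`: replacing a
concept by its children releases enough to pay for writing the concept and one list node to the
output. -/
theorem esize_children (C : EL) :
    (C.children.map esize).sum < esize C ∧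
      (C.children.map fun D => esize D ^ 2).sum + esize C + 1 ≤ esize C ^ 2 := by
  cases C with
  | atom A => simp [EL.children, esize, enc, encodeEL, Tree.size, encodeTag]; nlinarith
  | top => simp [EL.children, esize, enc, encodeEL, Tree.size, encodeTag]
  | bot => simp [EL.children, esize, enc, encodeEL, Tree.size, encodeTag]
  | inf C D =>
    simp [EL.children, esize, enc, encodeEL, Tree.size, encodeTag]
    refine ⟨by omega, ?_⟩
    nlinarith
  | ex r C =>
    simp [EL.children, esize, enc, encodeEL, Tree.size, encodeTag]
    refine ⟨by omega, ?_⟩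
    nlinarith

theorem sum_esize_sq_le (l : List EL) : (l.map fun D => esize D ^ 2).sum ≤ esize l ^ 2 := by
  induction l with
  | nil => simp
  | cons C l ih => simp only [List.map_cons, List.sum_cons, esize_cons]; nlinarith [Nat.zero_le (esize C * esize l)]

theorem esize_le_sum_sq (l : List EL) : esize l ≤ (l.map fun D => esize D ^ 2).sum + 1 ∧
    (l.map esize).sum ≤ (l.map fun D => esize D ^ 2).sum := by
  induction l with
  | nil => simp
  | cons C l ih =>
    have := (esize_children C).2
    simp only [List.map_cons, List.sum_cons, esize_cons]; omega

/-- Depth-first traversal with a worklist. Subconcepts are pushed onto the output as they are met,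
which explains the reversal; their order plays no role later. -/
theorem poly_flatMap_subs : Poly fun l : List EL => (l.flatMap EL.subs).reverse := by
  let c : List EL × List EL → Bool := fun s => !s.1.isEmpty
  let k : (List EL × List EL) × EL × List EL → List EL × List EL := fun q =>
    (q.2.1.children ++ q.2.2, q.2.1 :: q.1.2)
  let b : List EL × List EL → List EL × List EL := fun s => match s.1 with
    | [] => s
    | p :: w => k (s, p, w)
  have hk : Poly k := by fun_prop
  have hb : Poly b := (Poly.listCases .fst .id hk).congr fun s => by
    rcases s with ⟨_ | _, _⟩ <;> rfl
  have hc : Poly c := by fun_prop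
  have hinit : Poly fun l : List EL => (l, ([] : List EL)) := by fun_prop
  have key := Poly.loop hc hb hinit (fun s => ([], (s.1.flatMap EL.subs).reverse ++ s.2))
    (by rintro ⟨_ | ⟨x, l⟩, y⟩ hs <;> simp_all [c])
    (by
      rintro ⟨_ | ⟨x, l⟩, y⟩ hs
      · simp_all [c]
      · simp [b, k, EL.subs_eq x])
    (fun a s => esize s.2 + (s.1.map fun D => esize D ^ 2).sum ≤ esize a * esize a + 1)
    (fun s => (s.1.map esize).sum)
    ((PolyBdd.esize.mul .esize).add (.const 3))
    (fun a => by have := sum_esize_sq_le a; rw [pow_two] at this; simp; omega) ?_ ?_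
  · exact (Poly.snd.comp key).congr fun p => by simp
  · rintro a ⟨_ | ⟨x, l⟩, y⟩ ha hcs
    · simp [c] at hcs
    · have := esize_children x
      simp only [b, k, List.map_append, List.sum_append, List.map_cons, List.sum_cons,
        esize_cons] at ha ⊢
      omega
  · rintro a ⟨w, y⟩ ha
    have := esize_le_sum_sq w
    simp only [esize_prod] at ha ⊢
    have := esize_pos y
    omega

/-! ## Subsumption under materialised defeasible inclusions

`ρ = none` stands for a distinguished element that satisfies the left-hand side of the
subsumption and the materialisation of the defeasible inclusions; `some X` stands for an arbitrary
element of `X`. -/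

/-- Every instance of `C` in a model of `T` that satisfies the materialisations of the axioms of
`E` is an instance of `D`. -/
def MatEntails (T : TBox) (E : DBox) (C D : ALC) : Prop :=
  ∀ (Δ : Type) [Nonempty Δ] (I : Interp Δ), (∀ g ∈ T, I.Sat g) → ∀ o ∈ C.ext I,
    (∀ d ∈ E, o ∈ d.lhs.toALC.ext I → o ∈ d.rhs.toALC.ext I) → o ∈ D.ext I

/-- The statement that the first component is subsumed by the second one. -/
abbrev Fact : Type := Option EL × EL

/-- The subsumption problems `T`, `E`, `C`, `D` that are decided by saturation. -/
abbrev SubProblem : Type := TBox × DBox × EL × EL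

/-- The concepts that occur in the problem. -/
def occurring (P : SubProblem) : List EL :=
  ((EL.bot :: P.2.2.1 :: P.2.2.2 :: (P.1.flatMap (fun g => [g.lhs, g.rhs]) ++
    P.2.1.flatMap fun d => [d.lhs, d.rhs])).flatMap EL.subs).reverse

/-- The potential facts. -/
def allFacts (P : SubProblem) : List Fact :=
  (none :: (occurring P).map some).flatMap fun X => (occurring P).map fun Y => (X, Y)

/-- The subsumer of the fact follows from a subsumer `Z` of the same concept. -/
def stepVia (P : SubProblem) (X : Option EL) (Y Z : EL) : Bool :=
  decide (Z = .bot) ||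
  (P.1.any fun g => decide (g.lhs = Z) && decide (g.rhs = Y)) ||
  (decide (X = none) && P.2.1.any fun d => decide (d.lhs = Z) && decide (d.rhs = Y)) ||
  -- The guard leaves only conjunctions: the filler of an existential restriction does not subsume
  -- it.
  (Z.children.any fun W => decide (Z.unEx = none) && decide (W = Y))

/-- The subsumer of the fact follows by decomposition. -/
def stepDecomp (R : List Fact) (X : Option EL) (Y : EL) : Bool :=
  Y.unInf.elim false fun p => decide ((X, p.1) ∈ R) && decide ((X, p.2) ∈ R)

/-- The subsumer of the fact follows from an existential subsumer of the same concept. -/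
def stepEx (R : List Fact) (Y Z : EL) : Bool :=
  Z.unEx.elim false fun p =>
    (decide (Y = .bot) && decide ((some p.2, EL.bot) ∈ R)) ||
    (R.any fun f => decide (f.1 = some p.2) && decide (EL.ex p.1 f.2 = Y))

/-- One-step derivability of a fact from the facts in `R`. -/
def step (P : SubProblem) (R : List Fact) (f : Fact) : Bool :=
  decide (f.2 = .top) || decide (f.1 = some f.2) ||
  (decide (f.1 = none) && decide (f.2 = P.2.2.1)) ||
  stepDecomp R f.1 f.2 ||
  R.any fun f' => decide (f'.1 = f.1) && (stepVia P f.1 f.2 f'.2 || stepEx R f.2 f'.2)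

/-- The facts after one more round of derivations. -/
def saturateStep (P : SubProblem) (R : List Fact) : List Fact :=
  (allFacts P).filter fun f => decide (f ∈ R) || step P R f

/-- The derivable facts. -/
def saturate (P : SubProblem) : List Fact :=
  -- The elements are ignored; the list only supplies a number of rounds that suffices for
  -- stability.
  (allFacts P).foldl (fun R _ => saturateStep P R) []

/-- The decision procedure for `MatEntails`. -/
def sub (T : TBox) (E : DBox) (C D : EL) : Bool := decide ((none, D) ∈ saturate (T, E, C, D))

@[fun_prop]
theorem poly_occurring : Poly occurring := by
  unfold occurring
  exact poly_flatMap_subs.comp (g := fun P : SubProblem =>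
    EL.bot :: P.2.2.1 :: P.2.2.2 :: (P.1.flatMap (fun g => [g.lhs, g.rhs]) ++
      P.2.1.flatMap fun d => [d.lhs, d.rhs])) (by fun_prop)

@[fun_prop]
theorem poly_allFacts : Poly allFacts := by
  unfold allFacts
  fun_prop

theorem poly_stepVia :
    Poly fun q : SubProblem × Option EL × EL × EL => stepVia q.1 q.2.1 q.2.2.1 q.2.2.2 := by
  unfold stepVia
  fun_prop

theorem poly_stepDecomp :
    Poly fun q : List Fact × Option EL × EL => stepDecomp q.1 q.2.1 q.2.2 := by
  unfold stepDecomp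
  fun_prop

theorem poly_stepEx : Poly fun q : List Fact × EL × EL => stepEx q.1 q.2.1 q.2.2 := by
  unfold stepEx
  fun_prop

theorem poly_step : Poly fun q : SubProblem × List Fact × Fact => step q.1 q.2.1 q.2.2 := by
  unfold step
  have h₁ : Poly fun q : SubProblem × List Fact × Fact =>
      stepDecomp q.2.1 q.2.2.1 q.2.2.2 :=
    poly_stepDecomp.comp (g := fun q : SubProblem × List Fact × Fact =>
      (q.2.1, q.2.2.1, q.2.2.2)) (by fun_prop)
  have h₂ : Poly fun q : (SubProblem × List Fact × Fact) × Fact =>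
      stepVia q.1.1 q.1.2.2.1 q.1.2.2.2 q.2.2 :=
    poly_stepVia.comp (g := fun q : (SubProblem × List Fact × Fact) × Fact =>
      (q.1.1, q.1.2.2.1, q.1.2.2.2, q.2.2)) (by fun_prop)
  have h₃ : Poly fun q : (SubProblem × List Fact × Fact) × Fact =>
      stepEx q.1.2.1 q.1.2.2.2 q.2.2 :=
    poly_stepEx.comp (g := fun q : (SubProblem × List Fact × Fact) × Fact =>
      (q.1.2.1, q.1.2.2.2, q.2.2)) (by fun_prop)
  fun_prop

theorem poly_saturateStep :
    Poly fun q : SubProblem × List Fact => saturateStep q.1 q.2 := by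
  unfold saturateStep
  have h : Poly fun q : (SubProblem × List Fact) × Fact => step q.1.1 q.1.2 q.2 :=
    poly_step.comp (g := fun q : (SubProblem × List Fact) × Fact => (q.1.1, q.1.2, q.2))
      (by fun_prop)
  fun_prop

theorem saturateStep_sublist (P : SubProblem) (R : List Fact) :
    (saturateStep P R).Sublist (allFacts P) := List.filter_sublist

@[fun_prop]
theorem poly_saturate : Poly saturate := by
  unfold saturate
  refine Poly.foldl (step := fun P R _ => saturateStep P R) (by fun_prop) (.const [])
    (poly_saturateStep.comp (g := fun q : SubProblem × List Fact × Fact => (q.1, q.2.1))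
      (by fun_prop)) poly_allFacts.esize_le fun P l _ => ?_
  rw [List.foldl_const]
  cases l.length with
  | zero => exact esize_pos _
  | succ n =>
    rw [Function.iterate_succ_apply']
    exact esize_sublist (saturateStep_sublist _ _)

@[fun_prop]
theorem poly_sub {α : Type} [Enc α] {T : α → TBox} {E : α → DBox} {C D : α → EL} (hT : Poly T)
    (hE : Poly E) (hC : Poly C) (hD : Poly D) : Poly fun a => sub (T a) (E a) (C a) (D a) := by
  unfold sub
  have h : Poly fun a => saturate (T a, E a, C a, D a) :=
    poly_saturate.comp (g := fun a => (T a, E a, C a, D a)) (by fun_prop)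
  fun_prop

end DefeasibleEL

namespace DefeasibleEL

/-! ## Correctness of saturation -/

/-- Repeatedly adding the elements of `l` that satisfy a condition becomes stable after at most
`l.length` rounds. -/
theorem mem_iterate_filter {α : Type} [∀ (R : List α) (x : α), Decidable (x ∈ R)]
    (l : List α) (st : List α → α → Bool)
    {F : List α → List α} (hF : ∀ R, F R = l.filter fun x => decide (x ∈ R) || st R x) {x : α}
    (hx : x ∈ l) (h : st (F^[l.length] []) x = true) : x ∈ F^[l.length] [] := by
  have hsub : ∀ n, (F^[n] []).Sublist (F^[n + 1] []) := by
    intro n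
    obtain ⟨p, hp⟩ : ∃ p, F^[n] [] = l.filter p := by
      cases n with
      | zero => exact ⟨fun _ => false, by simp⟩
      | succ n => exact ⟨_, by rw [Function.iterate_succ_apply', hF]⟩
    -- Every iterate is a filter of `l`, hence the filter by membership in itself; this makes
    -- consecutive iterates comparable as sublists.
    have hp' : F^[n] [] = l.filter fun x => decide (x ∈ F^[n] []) := by
      conv_lhs => rw [hp]
      refine List.filter_congr fun x hx => ?_
      rw [Bool.eq_iff_iff, decide_eq_true_eq, hp, List.mem_filter]
      simp [hx]
    rw [Function.iterate_succ_apply', hF]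
    conv_lhs => rw [hp']
    exact List.monotone_filter_right l fun x hx => by rw [Bool.or_eq_true]; exact .inl hx
  by_contra hcon
  -- Two equal consecutive iterates would make the sequence constant from there on, and `x` would
  -- belong to the iterate after stage `l.length` and so to that stage itself. Without a repetition
  -- the iterates outgrow `l`.
  have hne : ∀ n ≤ l.length, F^[n + 1] [] ≠ F^[n] [] := by
    intro n hn heq
    have hstab : ∀ k, F^[n + k] [] = F^[n] [] := by
      intro k
      induction k with
      | zero => rfl
      | succ k ih => rw [← add_assoc, Function.iterate_succ_apply', ih,
          ← Function.iterate_succ_apply' F, heq]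
    have h₁ := hstab (l.length - n)
    have h₂ := hstab (l.length - n + 1)
    rw [show n + (l.length - n) = l.length by omega] at h₁
    rw [show n + (l.length - n + 1) = l.length + 1 by omega, ← h₁,
      Function.iterate_succ_apply', hF] at h₂
    exact hcon (h₂ ▸ List.mem_filter.2 ⟨hx, by simp [h]⟩)
  have hlen : ∀ n ≤ l.length + 1, n ≤ (F^[n] []).length := by
    intro n
    induction n with
    | zero => simp
    | succ n ih =>
      intro hn
      have := ih (by omega)
      have hs := hsub n
      have := hs.length_le
      have : (F^[n] []).length ≠ (F^[n + 1] []).length := fun hl =>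
        hne n (by omega) (hs.eq_of_length hl).symm
      omega
  have := hlen (l.length + 1) le_rfl
  rw [Function.iterate_succ_apply', hF] at this
  have := List.length_filter_le
    (fun x => decide (x ∈ F^[l.length] []) || st (F^[l.length] []) x) l
  omega

/-- The instances of the left-hand side of a fact. -/
def instances {Δ : Type} (I : Interp Δ) (o : Δ) (X : Option EL) : Set Δ :=
  X.elim {o} fun C => C.toALC.ext I

theorem step_sound {P : SubProblem} {R : List Fact} {f : Fact} (hf : step P R f = true) {Δ : Type}
    {I : Interp Δ} {o : Δ} (hT : ∀ g ∈ P.1, I.Sat g) (hC : o ∈ P.2.2.1.toALC.ext I)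
    (hE : ∀ d ∈ P.2.1, o ∈ d.lhs.toALC.ext I → o ∈ d.rhs.toALC.ext I)
    (hR : ∀ f ∈ R, instances I o f.1 ⊆ f.2.toALC.ext I) :
    instances I o f.1 ⊆ f.2.toALC.ext I := by
  obtain ⟨X, Y⟩ := f
  simp only [step, Bool.or_eq_true, Bool.and_eq_true, decide_eq_true_eq, List.any_eq_true] at hf
  rcases hf with (((h | h) | h) | h) | ⟨⟨X', Z⟩, hZ, h, h'⟩
  · subst h; exact fun _ _ => trivial
  · subst h; exact subset_rfl
  · obtain ⟨rfl, rfl⟩ := h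
    rintro _ rfl
    exact hC
  · cases Y <;> simp [stepDecomp, EL.unInf] at h
    exact Set.subset_inter (hR _ h.1) (hR _ h.2)
  · simp only at h h'
    subst h
    have hXZ := hR _ hZ
    simp only at hXZ
    rcases h' with h | h
    · simp only [stepVia, Bool.or_eq_true, Bool.and_eq_true, decide_eq_true_eq,
        List.any_eq_true] at h
      rcases h with ((rfl | ⟨g, hg, rfl, rfl⟩) | ⟨rfl, d, hd, rfl, rfl⟩) | ⟨W, hW, hZ, rfl⟩
      · exact fun p hp => (hXZ hp).elim
      · exact hXZ.trans (hT g hg)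
      · rintro _ rfl
        exact hE d hd (hXZ rfl)
      · cases Z <;> simp [EL.children, EL.unEx] at hW hZ
        rcases hW with rfl | rfl
        · exact fun p hp => (hXZ hp).1
        · exact fun p hp => (hXZ hp).2
    · cases Z <;> simp [stepEx, EL.unEx] at h
      rcases h with ⟨rfl, h⟩ | ⟨V, h, rfl⟩
      · intro p hp
        obtain ⟨p', -, hp'⟩ := hXZ hp
        exact (hR _ h hp').elim
      · intro p hp
        obtain ⟨p', hr, hp'⟩ := hXZ hp
        exact ⟨p', hr, hR _ h hp'⟩

theorem saturate_eq (P : SubProblem) :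
    saturate P = (saturateStep P)^[(allFacts P).length] [] := by
  rw [saturate, List.foldl_const]

theorem saturate_sound {P : SubProblem} {Δ : Type}
    {I : Interp Δ} {o : Δ} (hT : ∀ g ∈ P.1, I.Sat g) (hC : o ∈ P.2.2.1.toALC.ext I)
    (hE : ∀ d ∈ P.2.1, o ∈ d.lhs.toALC.ext I → o ∈ d.rhs.toALC.ext I) :
    ∀ f ∈ saturate P, instances I o f.1 ⊆ f.2.toALC.ext I := by
  rw [saturate_eq]
  generalize (allFacts P).length = n
  induction n with
  | zero => simp
  | succ n ih =>
    intro f hf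
    rw [Function.iterate_succ_apply', saturateStep, List.mem_filter, Bool.or_eq_true,
      decide_eq_true_eq] at hf
    rcases hf.2 with h | h
    · exact ih f h
    · exact step_sound h hT hC hE ih

theorem mem_saturate_of_step {P : SubProblem} {f : Fact} (hf : f ∈ allFacts P)
    (h : step P (saturate P) f = true) : f ∈ saturate P := by
  rw [saturate_eq] at h ⊢
  exact mem_iterate_filter (F := saturateStep P) _ (step P) (fun R => rfl) hf h

theorem mem_allFacts {P : SubProblem} {f : Fact} :
    f ∈ allFacts P ↔ (∀ C ∈ f.1, C ∈ occurring P) ∧ f.2 ∈ occurring P := by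
  obtain ⟨_ | X, Y⟩ := f <;> simp [allFacts]

theorem occurring_children {P : SubProblem} {C D : EL} (hC : C ∈ occurring P)
    (hD : D ∈ C.children) : D ∈ occurring P := by
  simp only [occurring, List.mem_reverse, List.mem_flatMap] at hC ⊢
  obtain ⟨E, hE, h⟩ := hC
  refine ⟨E, hE, EL.subs_trans h ?_⟩
  rw [EL.subs_eq]
  exact List.mem_cons_of_mem _ (List.mem_flatMap.2 ⟨D, hD, D.mem_subs_self⟩)

/-- The canonical model: its elements are the consistent left-hand sides. -/
def canonicalModel (P : SubProblem) :
    Interp {X : Option EL // (∀ C ∈ X, C ∈ occurring P) ∧ (X, EL.bot) ∉ saturate P} where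
  conc A := {X | (X.1, EL.atom A) ∈ saturate P}
  role r X Y := ∃ C, Y.1 = some C ∧ (X.1, EL.ex r C) ∈ saturate P

theorem bot_mem_occurring (P : SubProblem) : EL.bot ∈ occurring P := by
  simp [occurring, EL.subs]

/-- The truth lemma: extensions in the canonical model are exactly the derived facts. The
restriction to occurring concepts is needed because saturation derives facts about no others. -/
theorem canonicalModel_ext {P : SubProblem} {C : EL} (hC : C ∈ occurring P)
    (X : {X : Option EL // (∀ C ∈ X, C ∈ occurring P) ∧ (X, EL.bot) ∉ saturate P}) :
    X ∈ C.toALC.ext (canonicalModel P) ↔ (X.1, C) ∈ saturate P := by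
  induction C generalizing X with
  | atom A => rfl
  | top =>
    refine iff_of_true trivial (mem_saturate_of_step (mem_allFacts.2 ⟨X.2.1, hC⟩) ?_)
    simp [step]
  | bot => exact iff_of_false id X.2.2
  | inf C D ih ih' =>
    have h₁ := occurring_children hC (D := C) (by simp [EL.children])
    have h₂ := occurring_children hC (D := D) (by simp [EL.children])
    refine (and_congr (ih h₁ X) (ih' h₂ X)).trans ⟨fun h => ?_, fun h => ⟨?_, ?_⟩⟩
    · refine mem_saturate_of_step (mem_allFacts.2 ⟨X.2.1, hC⟩) ?_
      simp [step, stepDecomp, EL.unInf, h]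
    · refine mem_saturate_of_step (mem_allFacts.2 ⟨X.2.1, h₁⟩) ?_
      simp only [step, stepVia, Bool.or_eq_true, Bool.and_eq_true, decide_eq_true_eq,
        List.any_eq_true]
      exact .inr ⟨_, h, rfl, .inl (.inr ⟨C, by simp [EL.children], rfl, rfl⟩)⟩
    · refine mem_saturate_of_step (mem_allFacts.2 ⟨X.2.1, h₂⟩) ?_
      simp only [step, stepVia, Bool.or_eq_true, Bool.and_eq_true, decide_eq_true_eq,
        List.any_eq_true]
      exact .inr ⟨_, h, rfl, .inl (.inr ⟨D, by simp [EL.children], rfl, rfl⟩)⟩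
  | ex r C ih =>
    have h₁ := occurring_children hC (D := C) (by simp [EL.children])
    constructor
    · rintro ⟨Y, ⟨W, hY, hr⟩, hYC⟩
      rw [EL.toALC.eq_def] at *
      have hYC := (ih h₁ Y).1 hYC
      rw [hY] at hYC
      refine mem_saturate_of_step (mem_allFacts.2 ⟨X.2.1, hC⟩) ?_
      simp only [step, stepEx, Bool.or_eq_true, Bool.and_eq_true, decide_eq_true_eq,
        List.any_eq_true]
      refine .inr ⟨_, hr, rfl, .inr ?_⟩
      simp only [EL.unEx, Option.elim_some, Bool.or_eq_true, Bool.and_eq_true, decide_eq_true_eq,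
        List.any_eq_true]
      exact .inr ⟨_, hYC, rfl, rfl⟩
    · intro h
      -- The witness for `∃ r. C` is the element `some C`. It exists because an inconsistent filler
      -- would make `X` inconsistent.
      have hbot : (some C, EL.bot) ∉ saturate P := by
        intro hb
        refine X.2.2 (mem_saturate_of_step (mem_allFacts.2 ⟨X.2.1, bot_mem_occurring P⟩) ?_)
        simp only [step, stepEx, Bool.or_eq_true, Bool.and_eq_true, decide_eq_true_eq,
          List.any_eq_true]
        refine .inr ⟨_, h, rfl, .inr ?_⟩
        simp [EL.unEx, hb]
      refine ⟨⟨some C, by simpa using h₁, hbot⟩, ⟨C, rfl, h⟩, (ih h₁ _).2 ?_⟩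
      refine mem_saturate_of_step (mem_allFacts.2 ⟨by simpa using h₁, h₁⟩) ?_
      simp [step]

/-- Soundness holds rule by rule. For completeness, if `⊥` is not derived for `none`, then `none` is
a point `ρ` of the canonical model. By saturation `ρ` lies in `C` and satisfies the implications of
`E`, so an entailed `D` holds at `ρ` and is therefore derived. If `⊥` is derived, so is everything.
-/
theorem sub_iff (T : TBox) (E : DBox) (C D : EL) :
    sub T E C D = true ↔ MatEntails T E C.toALC D.toALC := by
  rw [sub, decide_eq_true_eq]
  have hocc : ∀ F ∈ EL.bot :: C :: D :: (T.flatMap (fun g => [g.lhs, g.rhs]) ++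
      E.flatMap fun d => [d.lhs, d.rhs]), F ∈ occurring (T, E, C, D) := fun F hF => by
    rw [occurring, List.mem_reverse]
    exact List.mem_flatMap.2 ⟨F, hF, F.mem_subs_self⟩
  have hT : ∀ g ∈ T, g.lhs ∈ occurring (T, E, C, D) ∧ g.rhs ∈ occurring (T, E, C, D) :=
    fun g hg => ⟨hocc _ (by simp; grind), hocc _ (by simp; grind)⟩
  have hE : ∀ g ∈ E, g.lhs ∈ occurring (T, E, C, D) ∧ g.rhs ∈ occurring (T, E, C, D) :=
    fun g hg => ⟨hocc _ (by simp; grind), hocc _ (by simp; grind)⟩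
  constructor
  · intro h Δ _ I hI o ho hoE
    exact saturate_sound (P := (T, E, C, D)) hI ho hoE _ h rfl
  · intro h
    by_cases hb : ((none, EL.bot) : Fact) ∈ saturate (T, E, C, D)
    · refine mem_saturate_of_step (mem_allFacts.2 ⟨by simp, hocc D (by simp)⟩) ?_
      simp only [step, stepVia, Bool.or_eq_true, Bool.and_eq_true, decide_eq_true_eq,
        List.any_eq_true]
      exact .inr ⟨_, hb, rfl, .inl (.inl (.inl (.inl rfl)))⟩
    · let ρ : {X : Option EL // (∀ F ∈ X, F ∈ occurring (T, E, C, D)) ∧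
        (X, EL.bot) ∉ saturate (T, E, C, D)} := ⟨none, by simp, hb⟩
      have : Nonempty {X : Option EL // (∀ F ∈ X, F ∈ occurring (T, E, C, D)) ∧
        (X, EL.bot) ∉ saturate (T, E, C, D)} := ⟨ρ⟩
      refine (canonicalModel_ext (hocc D (by simp)) ρ).1
        (h _ (canonicalModel (T, E, C, D)) (fun g hg X hX => ?_) ρ ?_ fun d hd hρ => ?_)
      · rw [canonicalModel_ext (hT g hg).1] at hX
        rw [canonicalModel_ext (hT g hg).2]
        refine mem_saturate_of_step (mem_allFacts.2 ⟨X.2.1, (hT g hg).2⟩) ?_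
        simp only [step, stepVia, Bool.or_eq_true, Bool.and_eq_true, decide_eq_true_eq,
          List.any_eq_true]
        exact .inr ⟨_, hX, rfl, .inl (.inl (.inl (.inr ⟨g, hg, rfl, rfl⟩)))⟩
      · rw [canonicalModel_ext (hocc C (by simp))]
        refine mem_saturate_of_step (mem_allFacts.2 ⟨ρ.2.1, hocc C (by simp)⟩) ?_
        simp [step, ρ]
      · rw [canonicalModel_ext (hE d hd).1] at hρ
        rw [canonicalModel_ext (hE d hd).2]
        refine mem_saturate_of_step (mem_allFacts.2 ⟨ρ.2.1, (hE d hd).2⟩) ?_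
        simp only [step, stepVia, Bool.or_eq_true, Bool.and_eq_true, decide_eq_true_eq,
          List.any_eq_true]
        exact .inr ⟨_, hρ, rfl, .inl (.inl (.inr ⟨rfl, d, hd, rfl, rfl⟩))⟩

end DefeasibleEL

namespace DefeasibleEL

/-! ## Basic properties of `MatEntails` -/

theorem MatEntails.mono {T : TBox} {E E' : DBox} {C D : ALC} (h : MatEntails T E C D)
    (hE : E ⊆ E') : MatEntails T E' C D :=
  fun Δ _ I hI o ho hm => h Δ I hI o ho fun d hd => hm d (hE hd)

theorem entails_iff (T : TBox) (C D : EL) : Entails T ⟨C, D⟩ ↔ MatEntails T [] C.toALC D.toALC :=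
  ⟨fun h Δ _ I hI _ ho _ => h Δ I hI ho, fun h Δ _ I hI o ho => h Δ I hI o ho (by simp)⟩

theorem ext_congr {Δ : Type} {I I' : Interp Δ} {n : ℕ} (hr : I.role = I'.role)
    (hc : ∀ A < n, I.conc A = I'.conc A) (C : EL) (hC : C.bound ≤ n) :
    C.toALC.ext I = C.toALC.ext I' := by
  induction C with
  | atom A => exact hc A hC
  | top => rfl
  | bot => rfl
  | inf C D ih ih' =>
    simp only [EL.bound, max_le_iff] at hC
    simp [EL.toALC, ALC.ext, ih hC.1, ih' hC.2]
  | ex r C ih => simp [EL.toALC, ALC.ext, hr, ih hC]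

/-- Given a point `o`, reinterpret `δ` as `{o}`: by freshness no other extension changes, and the
added axioms express exactly the implications at `o`. Conversely every instance of `δ` in a model of
the extended TBox satisfies these implications. -/
theorem entails_withDelta_iff {T : TBox} {E : DBox} {C D : EL} {δ : ℕ}
    (hT : ∀ g ∈ T, g.lhs.bound ≤ δ ∧ g.rhs.bound ≤ δ)
    (hE : ∀ d ∈ E, d.lhs.bound ≤ δ ∧ d.rhs.bound ≤ δ) (hC : C.bound ≤ δ) (hD : D.bound ≤ δ) :
    Entails (withDelta T δ E) ⟨.inf C (.atom δ), D⟩ ↔ MatEntails T E C.toALC D.toALC := by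
  constructor
  · intro h Δ _ I hI o ho hm
    let I' : Interp Δ := ⟨Function.update I.conc δ {o}, I.role⟩
    have key : ∀ F : EL, F.bound ≤ δ → F.toALC.ext I = F.toALC.ext I' := fun F hF =>
      ext_congr (n := δ) (I := I) (I' := I') rfl
        (fun A hA => (Function.update_of_ne hA.ne _ _).symm) F hF
    have hδ : I'.conc δ = {o} := Function.update_self ..
    rw [key D hD]
    refine h Δ I' ?_ ⟨key C hC ▸ ho, show o ∈ I'.conc δ by rw [hδ]; rfl⟩
    intro g hg
    simp only [withDelta, List.mem_append, List.mem_map] at hg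
    rcases hg with hg | ⟨d, hd, rfl⟩
    · have := hI g hg
      rwa [Interp.Sat, key _ (hT g hg).1, key _ (hT g hg).2] at this
    · rintro p ⟨hp, hp'⟩
      have hp' : p ∈ I'.conc δ := hp'
      rw [hδ] at hp'
      obtain rfl : p = o := hp'
      have := hm d hd
      rw [key _ (hE d hd).1, key _ (hE d hd).2] at this
      exact this hp
  · intro h Δ _ I hI o ho
    refine h Δ I (fun g hg => hI g (by simp [withDelta, hg])) o ho.1 fun d hd hod => ?_
    exact hI ⟨.inf d.lhs (.atom δ), d.rhs⟩ (by simp [withDelta]; exact .inr ⟨d, hd, rfl, rfl⟩)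
      ⟨hod, ho.2⟩

theorem le_foldr_max {l : List ℕ} {n : ℕ} (h : n ∈ l) : n ≤ l.foldr max 0 := by
  induction l with
  | nil => simp at h
  | cons m l ih =>
    rcases List.mem_cons.1 h with rfl | h
    · exact le_max_left _ _
    · exact (ih h).trans (le_max_right _ _)

theorem freshAtom_spec (T : TBox) (E : DBox) (Cs : List EL) :
    (∀ g ∈ T, g.lhs.bound ≤ freshAtom T E Cs ∧ g.rhs.bound ≤ freshAtom T E Cs) ∧
    (∀ d ∈ E, d.lhs.bound ≤ freshAtom T E Cs ∧ d.rhs.bound ≤ freshAtom T E Cs) ∧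
    ∀ C ∈ Cs, C.bound ≤ freshAtom T E Cs := by
  refine ⟨fun g hg => ?_, fun d hd => ?_, fun C hC => ?_⟩
  · exact max_le_iff.1 (le_foldr_max (by simp; exact .inl ⟨g, hg, rfl⟩))
  · exact max_le_iff.1 (le_foldr_max (by simp; exact .inr (.inl ⟨d, hd, rfl⟩)))
  · exact le_foldr_max (by simp; exact .inr (.inr ⟨C, hC, rfl⟩))

/-! ## The procedures as functions -/

@[simp] theorem Proc.result_pure {α : Type} (a : α) : (pure a : Proc α).result = a := rfl

@[simp] theorem Proc.tests_pure {α : Type} (a : α) : (pure a : Proc α).tests = [] := rfl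

theorem Proc.runWith_bind {α β : Type} (o : TBox → GCI → Bool) (P : Proc α) (f : α → Proc β) :
    (P >>= f).runWith o = (((f (P.runWith o).1).runWith o).1,
      (P.runWith o).2 ++ ((f (P.runWith o).1).runWith o).2) := by
  induction P with
  | done a => rfl
  | test T g k ih =>
    have := ih (o T g)
    change ((Proc.test T g k).bind f).runWith o = _
    change ((k (o T g)).bind f).runWith o = _ at this
    simp only [Proc.bind, Proc.runWith, this, List.cons_append]

@[simp] theorem Proc.result_bind {α β : Type} (P : Proc α) (f : α → Proc β) :
    (P >>= f).result = (f P.result).result := by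
  simp only [result, run, runWith_bind]

@[simp] theorem Proc.tests_bind {α β : Type} (P : Proc α) (f : α → Proc β) :
    (P >>= f).tests = P.tests ++ (f P.result).tests := by
  simp only [result, tests, run, runWith_bind]

open Classical in
@[simp] theorem result_ask (T : TBox) (g : GCI) : (ask T g).result = decide (Entails T g) := rfl

@[simp] theorem tests_ask (T : TBox) (g : GCI) : (ask T g).tests = [(T, g)] := rfl

theorem result_ask_eq (T : TBox) (C D : EL) : (ask T ⟨C, D⟩).result = sub T [] C D := by
  classical
  rw [result_ask, Bool.eq_iff_iff, decide_eq_true_eq, entails_iff, sub_iff]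

theorem result_ask_withDelta {T : TBox} {E : DBox} {C D : EL} {δ : ℕ}
    (hT : ∀ g ∈ T, g.lhs.bound ≤ δ ∧ g.rhs.bound ≤ δ)
    (hE : ∀ d ∈ E, d.lhs.bound ≤ δ ∧ d.rhs.bound ≤ δ) (hC : C.bound ≤ δ) (hD : D.bound ≤ δ) :
    (ask (withDelta T δ E) ⟨.inf C (.atom δ), D⟩).result = sub T E C D := by
  classical
  rw [result_ask, Bool.eq_iff_iff, decide_eq_true_eq, entails_withDelta_iff hT hE hC hD, sub_iff]

/-- The axioms of `E` that are exceptional w.r.t. the materialisation. -/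
def exc (T : TBox) (E : DBox) : DBox := E.filter fun d => sub T E d.lhs .bot

theorem exc_sublist (T : TBox) (E : DBox) : (exc T E).Sublist E := List.filter_sublist

theorem exc_length_lt {T : TBox} {E : DBox} (h : exc T E ≠ E) : (exc T E).length < E.length :=
  lt_of_le_of_ne (exc_sublist T E).length_le fun hl => h ((exc_sublist T E).eq_of_length hl)

theorem result_exceptional (T : TBox) (E : DBox) : (exceptional T E).result.1 = exc T E := by
  obtain ⟨h₁, h₂, -⟩ := freshAtom_spec T E []
  rw [exceptional, exc]
  generalize freshAtom T E [] = δ at *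
  -- The TBox contains the materialisation of all of `E` while the loop consumes its list, so the
  -- induction runs over lists contained in a fixed `E`.
  have key : ∀ E' ⊆ E, (exceptionalLoop (withDelta T δ E) δ E').result.1 =
      E'.filter fun d => sub T E d.lhs .bot := by
    intro E'
    induction E' with
    | nil => intro _; rfl
    | cons d E' ih =>
      intro hE'
      simp only [List.cons_subset] at hE'
      simp only [exceptionalLoop, Proc.result_bind, Proc.result_pure, List.filter_cons,
        ← ih hE'.2]
      rw [result_ask_withDelta h₁ h₂ (h₂ d hE'.1).1 (Nat.zero_le _)]
      split <;> rfl
  exact key E (List.Subset.refl E)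

/-- The sequence that is computed by the inner loop. -/
def excChain (T : TBox) (E : DBox) : List DBox :=
  if _h : exc T E = E then [E] else E :: excChain T (exc T E)
termination_by E.length
decreasing_by exact exc_length_lt _h

/-- The last element of `excChain`. -/
def excLimit (T : TBox) (E : DBox) : DBox :=
  if _h : exc T E = E then E else excLimit T (exc T E)
termination_by E.length
decreasing_by exact exc_length_lt _h

theorem excLimit_sublist (T : TBox) (E : DBox) : (excLimit T E).Sublist E := by
  induction hn : E.length using Nat.strong_induction_on generalizing E with
  | _ n ih =>
    subst hn
    rw [excLimit]
    split_ifs with h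
    · rfl
    · exact (ih _ (exc_length_lt h) _ rfl).trans (exc_sublist T E)

theorem exc_excLimit (T : TBox) (E : DBox) : exc T (excLimit T E) = excLimit T E := by
  induction hn : E.length using Nat.strong_induction_on generalizing E with
  | _ n ih =>
    subst hn
    rw [excLimit]
    split_ifs with h
    · exact h
    · exact ih _ (exc_length_lt h) _ rfl

theorem result_exceptionalChain (T : TBox) (E : DBox) :
    (exceptionalChain T E).result.1 = excChain T E ∧
      (exceptionalChain T E).result.2.1 = excLimit T E := by
  induction hn : E.length using Nat.strong_induction_on generalizing E with
  | _ n ih =>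
    subst hn
    have he := result_exceptional T E
    rw [exceptionalChain, excChain, excLimit]
    simp only [Proc.result_bind]
    split
    next h =>
      rw [he] at h
      simp [h]
    next h =>
      rw [he] at h
      have := ih _ (exc_length_lt h) _ rfl
      rw [← he] at this
      rw [dif_neg h, dif_neg h, ← he]
      simp only [Proc.result_bind, Proc.result_pure]
      exact ⟨congrArg _ this.1, this.2⟩

/-- The classical part of the axioms that are found to have infinite rank. -/
def emptyAxioms (E : DBox) : TBox := E.map fun d => ⟨d.lhs, .bot⟩

/-- The TBox and the DBox that are computed by the outer loop. -/
def rankPair (T : TBox) (D : DBox) : TBox × DBox :=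
  if _h : excLimit T D = [] then (T, D)
  else rankPair (T ++ emptyAxioms (excLimit T D)) (D.diff (excLimit T D))
termination_by D.length
decreasing_by exact DBox.diff_length_lt (excLimit_sublist T D) _h

/-- The partition by ranks. -/
def excRanks (T : TBox) (E : DBox) : List DBox :=
  List.zipWith DBox.diff (excChain T E) (excChain T E).tail

theorem excLimit_rankPair (T : TBox) (D : DBox) :
    excLimit (rankPair T D).1 (rankPair T D).2 = [] := by
  induction hn : D.length using Nat.strong_induction_on generalizing T D with
  | _ n ih =>
    subst hn
    rw [rankPair]
    split_ifs with h
    · exact h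
    · exact ih _ (DBox.diff_length_lt (excLimit_sublist T D) h) _ _ rfl

theorem result_rankingLoop (T : TBox) (D : DBox) :
    (rankingLoop T D).result = ⟨(rankPair T D).1, (rankPair T D).2,
      excRanks (rankPair T D).1 (rankPair T D).2⟩ := by
  induction hn : D.length using Nat.strong_induction_on generalizing T D with
  | _ n ih =>
    subst hn
    have he := result_exceptionalChain T D
    rw [rankingLoop, rankPair]
    simp only [Proc.result_bind]
    split
    next h =>
      rw [he.2] at h
      simp [h, he.1, excRanks]
    next h =>
      rw [he.2] at h
      rw [dif_neg h, ← he.2]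
      rw [← he.2] at h
      exact ih _ (DBox.diff_length_lt (exceptionalChain T D).result.2.2 h) _ _ rfl

theorem result_computeRanking (K : KB) :
    (computeRanking K).result = ⟨(rankPair K.tbox K.dbox).1, (rankPair K.tbox K.dbox).2,
      excRanks (rankPair K.tbox K.dbox).1 (rankPair K.tbox K.dbox).2⟩ :=
  result_rankingLoop _ _

/-- The first set in the sequence of `E` for which `C` is not exceptional, or the last one. -/
def search (T : TBox) (C : EL) (E : DBox) : DBox :=
  if _h : sub T E C .bot = true ∧ exc T E ≠ E then search T C (exc T E) else E
termination_by E.length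
decreasing_by exact exc_length_lt _h.2

theorem excRanks_of_eq {T : TBox} {E : DBox} (h : exc T E = E) : excRanks T E = [] := by
  rw [excRanks, excChain]
  simp [h]

theorem excRanks_of_ne {T : TBox} {E : DBox} (h : exc T E ≠ E) :
    excRanks T E = E.diff (exc T E) :: excRanks T (exc T E) := by
  have h₂ : ∃ l, excChain T (exc T E) = exc T E :: l := by
    rw [excChain]
    split_ifs
    · exact ⟨_, rfl⟩
    · exact ⟨_, rfl⟩
  obtain ⟨l, hl⟩ := h₂
  rw [excRanks, excRanks, excChain, dif_neg h]
  simp [hl]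

/-- RationalClosure removes layers `E_i \ E_{i+1}`; this shows that it thereby reaches `E_{i+1}`
itself, as a list and not only as a set. -/
theorem diff_diff_filter (E : DBox) (p : DGCI → Bool) :
    E.diff (E.diff (E.filter p)) = E.filter p := by
  simp only [DBox.diff]
  refine List.filter_congr fun d hd => ?_
  rw [Bool.eq_iff_iff]
  simp [hd]

theorem result_rankSearch (T : TBox) (C D : EL) (E : DBox) (hE : excLimit T E = []) :
    (rankSearch T C D (excRanks T E) E).result = search T C E := by
  induction hn : E.length using Nat.strong_induction_on generalizing E with
  | _ n ih =>
    subst hn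
    obtain ⟨h₁, h₂, h₃⟩ := freshAtom_spec T E [C, D]
    have hb := result_ask_withDelta (C := C) (D := .bot) h₁ h₂ (h₃ C (by simp)) (Nat.zero_le _)
    rw [search]
    by_cases h : exc T E = E
    · simp [excRanks_of_eq h, rankSearch, h]
    · rw [excRanks_of_ne h, rankSearch]
      have hne : E ≠ [] := by
        rintro rfl
        exact h rfl
      simp only [Proc.result_bind, hb, ne_eq, hne, not_false_eq_true, and_true, h]
      split_ifs with hs
      · have : E.diff (E.diff (exc T E)) = exc T E := diff_diff_filter E _
        rw [this]
        refine ih _ (exc_length_lt h) _ ?_ rfl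
        rwa [excLimit, dif_neg h] at hE
      · rfl

end DefeasibleEL

namespace DefeasibleEL

/-! ## Ranked models -/

theorem exists_minimal {Δ : Type} (R : RankedInterp Δ) {X : Set Δ} (hX : X.Nonempty) :
    (R.minimals X).Nonempty := by
  obtain ⟨rk, hrk⟩ := R.modular
  obtain ⟨x, hx, hmin⟩ := exists_minimalFor_of_wellFoundedLT (· ∈ X) rk hX
  refine ⟨x, hx, ?_⟩
  rintro ⟨y, hy, hyx⟩
  rw [hrk] at hyx
  exact absurd (hmin hy hyx.le) (by omega)

theorem minimals_of_subset {Δ : Type} (R : RankedInterp Δ) {X Y : Set Δ} (h : X ⊆ Y) {x : Δ}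
    (hx : x ∈ X) (hY : x ∈ R.minimals Y) : x ∈ R.minimals X :=
  ⟨hx, fun ⟨y, hy, hyx⟩ => hY.2 ⟨y, h hy, hyx⟩⟩

/-- If some left-hand side had an instance, take a minimal point of the union of all left-hand
sides. It is minimal in each one containing it, hence satisfies all implications of `E`; but it lies
in a left-hand side that is inconsistent with them. -/
theorem satisfies_emptyAxioms {T : TBox} {E : DBox} (hE : exc T E = E) {Δ : Type} [Nonempty Δ]
    {R : RankedInterp Δ} (hT : ∀ g ∈ T, R.toInterp.Sat g)
    (hR : ∀ d ∈ E, R.SatD d.lhs.toALC d.rhs.toALC) : ∀ g ∈ emptyAxioms E, R.toInterp.Sat g := by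
  intro g hg
  obtain ⟨d, hd, rfl⟩ := List.mem_map.1 hg
  intro o ho
  obtain ⟨p, ⟨⟨d', hd', hp⟩, hmin⟩⟩ := exists_minimal R
    (X := {o | ∃ d ∈ E, o ∈ d.lhs.toALC.ext R.toInterp}) ⟨o, d, hd, ho⟩
  have hent : MatEntails T E d'.lhs.toALC ALC.bot := by
    rw [← hE, exc, List.mem_filter, sub_iff] at hd'
    exact hd'.2
  refine (hent Δ R.toInterp hT p hp fun d'' hd'' hp'' => hR d'' hd'' ?_).elim
  exact minimals_of_subset R (Y := {o | ∃ d ∈ E, o ∈ d.lhs.toALC.ext R.toInterp})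
    (fun q hq => ⟨d'', hd'', hq⟩) hp'' ⟨⟨d', hd', hp⟩, hmin⟩

theorem rankPair_spec (T : TBox) (D : DBox) :
    (rankPair T D).2.Sublist D ∧ T ⊆ (rankPair T D).1 ∧
      ∀ d ∈ D, d ∉ (rankPair T D).2 → GCI.mk d.lhs .bot ∈ (rankPair T D).1 := by
  induction hn : D.length using Nat.strong_induction_on generalizing T D with
  | _ n ih =>
    subst hn
    rw [rankPair]
    split_ifs with h
    · exact ⟨List.Sublist.refl _, List.Subset.refl _, fun d hd hd' => absurd hd hd'⟩
    · obtain ⟨h₁, h₂, h₃⟩ := ih _ (DBox.diff_length_lt (excLimit_sublist T D) h)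
        (T ++ emptyAxioms (excLimit T D)) (D.diff (excLimit T D)) rfl
      refine ⟨h₁.trans List.filter_sublist, List.Subset.trans (List.subset_append_left _ _) h₂,
        fun d hd hd' => ?_⟩
      by_cases hdl : d ∈ excLimit T D
      · exact h₂ (List.mem_append_right _ (List.mem_map.2 ⟨d, hdl, rfl⟩))
      · exact h₃ d (by simp [DBox.diff, hd, hdl]) hd'

/-- Each round discards a set that is its own exceptional set, so `satisfies_emptyAxioms` needs only
the axioms being discarded. Demanding no more of `R` makes the result applicable to models of the
later stages, which lack other axioms. -/
theorem satisfies_rankPair {T : TBox} {D : DBox} {Δ : Type} [Nonempty Δ]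
    {R : RankedInterp Δ} (hT : ∀ g ∈ T, R.toInterp.Sat g)
    (hR : ∀ d ∈ D, d ∉ (rankPair T D).2 → R.SatD d.lhs.toALC d.rhs.toALC) :
    ∀ g ∈ (rankPair T D).1, R.toInterp.Sat g := by
  induction hn : D.length using Nat.strong_induction_on generalizing T D with
  | _ n ih =>
    subst hn
    rw [rankPair] at hR ⊢
    split_ifs at hR ⊢ with h
    · exact hT
    · refine ih _ (DBox.diff_length_lt (excLimit_sublist T D) h) (fun g hg => ?_)
        (fun d hd => hR d (List.filter_sublist.subset hd)) rfl
      rcases List.mem_append.1 hg with hg | hg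
      · exact hT g hg
      · refine satisfies_emptyAxioms (exc_excLimit T D) hT (fun d hd => ?_) g hg
        refine hR d ((excLimit_sublist T D).subset hd) fun hd' => ?_
        have := (rankPair_spec _ _).1.subset hd'
        simp [DBox.diff, hd] at this

/-! ## Disjoint unions of interpretations -/

/-- The disjoint union of a family of interpretations. -/
def sigmaInterp {ι : Type} {Δ : ι → Type} (I : ∀ i, Interp (Δ i)) : Interp (Σ i, Δ i) where
  conc A := {x | x.2 ∈ (I x.1).conc A}
  role r x y := ∃ h : y.1 = x.1, (I x.1).role r x.2 (h ▸ y.2)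

theorem mem_ext_sigmaInterp {ι : Type} {Δ : ι → Type} (I : ∀ i, Interp (Δ i)) (C : ALC)
    (x : Σ i, Δ i) : x ∈ C.ext (sigmaInterp I) ↔ x.2 ∈ C.ext (I x.1) := by
  induction C generalizing x with
  | atom A => rfl
  | top => exact iff_of_true trivial trivial
  | bot => exact Iff.rfl
  | inf C D ih ih' => exact and_congr (ih x) (ih' x)
  | neg C ih => exact not_congr (ih x)
  | ex r C ih =>
    obtain ⟨i, x⟩ := x
    constructor
    · rintro ⟨⟨j, y⟩, ⟨h, hr⟩, hy⟩
      obtain rfl : j = i := h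
      exact ⟨y, hr, (ih _).1 hy⟩
    · rintro ⟨y, hr, hy⟩
      exact ⟨⟨i, y⟩, ⟨rfl, hr⟩, (ih _).2 hy⟩

/-! ## Exceptionality and materialisation -/

theorem exc_iterate_sublist (T : TBox) (E : DBox) {m n : ℕ} (h : m ≤ n) :
    ((exc T)^[n] E).Sublist ((exc T)^[m] E) := by
  induction n, h using Nat.le_induction with
  | base => rfl
  | succ n _ ih =>
    rw [Function.iterate_succ_apply']
    exact (exc_sublist T _).trans ih

theorem exists_iterate_eq_excLimit (T : TBox) (E : DBox) : ∃ n, (exc T)^[n] E = excLimit T E := by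
  induction hn : E.length using Nat.strong_induction_on generalizing E with
  | _ n ih =>
    subst hn
    rw [excLimit]
    split_ifs with h
    · exact ⟨0, rfl⟩
    · obtain ⟨n, hn⟩ := ih _ (exc_length_lt h) _ rfl
      exact ⟨n + 1, hn⟩

theorem exists_witness {T : TBox} {E : DBox} {C : ALC} (h : ¬ MatEntails T E C .bot) :
    ∃ (Δ : Type) (I : Interp Δ) (o : Δ), (∀ g ∈ T, I.Sat g) ∧ o ∈ C.ext I ∧
      ∀ d ∈ E, o ∈ d.lhs.toALC.ext I → o ∈ d.rhs.toALC.ext I := by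
  simp only [MatEntails, not_forall] at h
  obtain ⟨Δ, _, I, hI, o, ho, hm, -⟩ := h
  exact ⟨Δ, I, o, hI, ho, hm⟩

/-- If the classical inclusions of `T` make the axioms of `F` outside `E` void and the exceptional
axioms of `E` run out, then a concept that is consistent with the materialisation of `E` is an
instance of a minimal element of some ranked model. -/
theorem exists_rankedModel {T : TBox} {E : DBox} {C : ALC} {n : ℕ} (hn : (exc T)^[n] E = [])
    (hC : ¬ MatEntails T E C .bot) :
    ∃ (Δ : Type) (R : RankedInterp Δ) (o : Δ), (∀ g ∈ T, R.toInterp.Sat g) ∧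
      (∀ d ∈ E, R.SatD d.lhs.toALC d.rhs.toALC) ∧ o ∈ C.ext R.toInterp ∧
        o ∈ R.minimals Set.univ := by
  classical
  obtain ⟨Δ₀, I₀, o₀, hT₀, ho₀, hm₀⟩ := exists_witness hC
  -- One component for each stage and each inclusion whose left-hand side is consistent with that
  -- stage; the index `none` adds a component for `C`.
  have hw : ∀ p : {p : ℕ × DGCI // ¬ MatEntails T ((exc T)^[p.1] E) p.2.lhs.toALC .bot},
      _ := fun p => exists_witness p.2
  choose Δ₁ I₁ o₁ hT₁ ho₁ hm₁ using hw
  let ι := Option {p : ℕ × DGCI // ¬ MatEntails T ((exc T)^[p.1] E) p.2.lhs.toALC .bot}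
  let Δ : ι → Type := fun k => k.elim Δ₀ Δ₁
  let I : ∀ k : ι, Interp (Δ k) := fun k => match k with
    | none => I₀
    | some p => I₁ p
  have hT : ∀ k, ∀ g ∈ T, (I k).Sat g := fun k => match k with
    | none => hT₀
    | some p => hT₁ p
  let J := sigmaInterp I
  let good : (Σ k, Δ k) → ℕ → Prop := fun x j => ∀ d ∈ (exc T)^[j] E,
    x ∈ d.lhs.toALC.ext J → x ∈ d.rhs.toALC.ext J
  -- The rank of a point is the first stage whose implications it satisfies. It exists because stage
  -- `n` is empty and imposes no condition.
  have hgood : ∀ x, ∃ j, good x j := fun x => ⟨n, by simp [good, hn]⟩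
  let rk : (Σ k, Δ k) → ℕ := fun x => Nat.find (hgood x)
  let R : RankedInterp (Σ k, Δ k) :=
    { J with prec := fun x y => rk x < rk y, modular := ⟨rk, fun _ _ => Iff.rfl⟩ }
  refine ⟨_, R, ⟨none, o₀⟩, fun g hg x hx => ?_, fun d hd x hx => ?_, ?_, trivial, ?_⟩
  · rw [mem_ext_sigmaInterp] at hx ⊢
    exact hT x.1 g hg hx
  -- The stage `j` at which `d` leaves the sequence. There the left-hand side of `d` is consistent,
  -- so it has a witness `w` of rank at most `j`.
  · obtain ⟨j, hj₁, hj₂⟩ : ∃ j, d ∈ (exc T)^[j] E ∧ d ∉ (exc T)^[j + 1] E := by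
      by_contra hcon
      push Not at hcon
      have : ∀ j, d ∈ (exc T)^[j] E := fun j => by
        induction j with
        | zero => exact hd
        | succ j ih => exact hcon j ih
      simpa [hn] using this n
    have hj : ¬ MatEntails T ((exc T)^[j] E) d.lhs.toALC .bot := by
      rw [Function.iterate_succ_apply', exc, List.mem_filter] at hj₂
      exact fun h => hj₂ ⟨hj₁, (sub_iff _ _ _ .bot).2 h⟩
    let w : Σ k, Δ k := ⟨some ⟨(j, d), hj⟩, o₁ ⟨(j, d), hj⟩⟩
    have hwj : rk w ≤ j := Nat.find_min' _ fun d' hd' hw' => by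
      rw [mem_ext_sigmaInterp] at hw' ⊢
      exact hm₁ ⟨(j, d), hj⟩ d' hd' hw'
    have hwd : w ∈ d.lhs.toALC.ext J := by
      rw [mem_ext_sigmaInterp]
      exact ho₁ ⟨(j, d), hj⟩
    -- Minimality of `x` against `w`. Thus `x` satisfies the implications of an earlier or equal
    -- stage, which still contains `d`.
    have hxw : rk x ≤ j := by
      by_contra hlt
      exact hx.2 ⟨w, hwd, show rk w < rk x by omega⟩
    exact Nat.find_spec (hgood x) d ((exc_iterate_sublist T E hxw).subset hj₁) hx.1
  · rw [mem_ext_sigmaInterp]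
    exact ho₀
  · rintro ⟨y, -, hy⟩
    have : rk ⟨none, o₀⟩ ≤ 0 := Nat.find_min' _ fun d' hd' hw' => by
      rw [mem_ext_sigmaInterp] at hw' ⊢
      exact hm₀ d' hd' hw'
    have hy : rk y < rk ⟨none, o₀⟩ := hy
    omega

/-- A concept consistent with `E` has a minimal instance in the model of `exists_rankedModel`, where
the discarded axioms hold because their left-hand sides are empty. Conversely, a minimal point of a
ranked model of `F` satisfies all implications of `E`, and the model satisfies the enlarged TBox by
`satisfies_rankPair`. -/
theorem exceptional_iff {T : TBox} {D E F : DBox} {n : ℕ}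
    (hn : (exc (rankPair T D).1)^[n] E = [])
    (hF : ∀ d, d ∈ F ↔ d ∈ E ∨ d ∈ D ∧ d ∉ (rankPair T D).2) (C : ALC) :
    Exceptional ⟨T, F⟩ C ↔ MatEntails (rankPair T D).1 E C .bot := by
  obtain ⟨-, h₂, h₃⟩ := rankPair_spec T D
  constructor
  · intro h
    by_contra hC
    obtain ⟨Δ, R, o, hT, hE, ho, hmin⟩ := exists_rankedModel hn hC
    have : Nonempty Δ := ⟨o⟩
    refine h Δ R ⟨fun g hg => hT g (h₂ hg), fun d hd => ?_⟩ hmin ho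
    rcases (hF d).1 hd with hd | ⟨hd, hd'⟩
    · exact hE d hd
    · exact fun x hx => (hT _ (h₃ d hd hd') hx.1).elim
  · intro h Δ _ R hR o ho hoC
    have hT := satisfies_rankPair (D := D) hR.1 fun d hd hd' => hR.2 d ((hF d).2 (.inr ⟨hd, hd'⟩))
    refine h Δ R.toInterp hT o hoC fun d hd hod => hR.2 d ((hF d).2 (.inl hd)) ?_
    exact minimals_of_subset R (fun _ _ => trivial) hod ho

theorem exists_iterate_rankPair (T : TBox) (D : DBox) (i : ℕ) :
    ∃ n, (exc (rankPair T D).1)^[n] ((exc (rankPair T D).1)^[i] (rankPair T D).2) = [] := by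
  obtain ⟨n, hn⟩ := exists_iterate_eq_excLimit (rankPair T D).1 (rankPair T D).2
  rw [excLimit_rankPair] at hn
  refine ⟨n, ?_⟩
  rw [← Function.iterate_add_apply]
  exact List.sublist_nil.1 (hn ▸ exc_iterate_sublist _ _ (Nat.le_add_right n i))

/-- The discarded axioms have left-hand sides that the enlarged TBox makes empty, so they are
exceptional at every stage and never leave `remaining`. All other axioms follow the iterates of
`exc`. -/
theorem mem_remaining_iff (K : KB) (i : ℕ) (d : DGCI) :
    d ∈ remaining K i ↔ d ∈ (exc (rankPair K.tbox K.dbox).1)^[i] (rankPair K.tbox K.dbox).2 ∨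
      d ∈ K.dbox ∧ d ∉ (rankPair K.tbox K.dbox).2 := by
  classical
  obtain ⟨h₁, -, h₃⟩ := rankPair_spec K.tbox K.dbox
  induction i generalizing d with
  | zero =>
    have := h₁.subset (a := d)
    simp only [remaining, Function.iterate_zero, id]
    tauto
  | succ i ih =>
    obtain ⟨n, hn⟩ := exists_iterate_rankPair K.tbox K.dbox i
    rw [remaining, List.mem_filter, decide_eq_true_eq, exceptional_iff hn ih, ih,
      Function.iterate_succ_apply', exc, List.mem_filter, sub_iff]
    constructor
    · rintro ⟨h | h, h'⟩
      · exact .inl ⟨h, h'⟩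
      · exact .inr h
    · rintro (h | h)
      · exact ⟨.inl h.1, h.2⟩
      · exact ⟨.inr h, fun Δ _ I hI o ho _ => hI _ (h₃ d h.1 h.2) ho⟩

theorem exceptional_remaining_iff (K : KB) (i : ℕ) (C : ALC) :
    Exceptional ⟨K.tbox, remaining K i⟩ C ↔ MatEntails (rankPair K.tbox K.dbox).1
      ((exc (rankPair K.tbox K.dbox).1)^[i] (rankPair K.tbox K.dbox).2) C .bot := by
  obtain ⟨n, hn⟩ := exists_iterate_rankPair K.tbox K.dbox i
  exact exceptional_iff hn (mem_remaining_iff K i) C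

/-! ### Ranks of concepts and correctness of RationalClosure -/

theorem rank_le {K : KB} {C : ALC} {i : ℕ} (h : ¬ Exceptional ⟨K.tbox, remaining K i⟩ C) :
    rank K C ≤ i := sInf_le ⟨i, rfl, h⟩

theorem le_rank {K : KB} {C : ALC} {n : ℕ∞}
    (h : ∀ i : ℕ, i < n → Exceptional ⟨K.tbox, remaining K i⟩ C) : n ≤ rank K C := by
  refine le_sInf ?_
  rintro _ ⟨i, rfl, hi⟩
  by_contra hlt
  exact hi (h i (not_le.1 hlt))

theorem search_spec (T : TBox) (C : EL) (E : DBox) : ∃ i, search T C E = (exc T)^[i] E ∧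
    (∀ j < i, sub T ((exc T)^[j] E) C .bot = true) ∧
      (sub T (search T C E) C .bot = true → exc T (search T C E) = search T C E) := by
  induction hn : E.length using Nat.strong_induction_on generalizing E with
  | _ n ih =>
    subst hn
    rw [search]
    split_ifs with h
    · obtain ⟨i, h₁, h₂, h₃⟩ := ih _ (exc_length_lt h.2) _ rfl
      refine ⟨i + 1, h₁, ?_, h₃⟩
      rintro (_ | j) hj
      · exact h.1
      · exact h₂ j (by omega)
    · exact ⟨0, rfl, by simp, fun hs => by_contra fun hne => h ⟨hs, hne⟩⟩

theorem matEntails_inf_neg (T : TBox) (E : DBox) (C D : ALC) :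
    MatEntails T E (.inf C (.neg D)) .bot ↔ MatEntails T E C D := by
  constructor
  · exact fun h Δ _ I hI o ho hm => by_contra fun hD => h Δ I hI o ⟨ho, hD⟩ hm
  · exact fun h Δ _ I hI o ho hm => ho.2 (h Δ I hI o ho.1 hm)

theorem matEntails_inf_left {T : TBox} {E : DBox} {C : ALC} (D : ALC)
    (h : MatEntails T E C .bot) : MatEntails T E (.inf C D) .bot :=
  fun Δ _ I hI o ho hm => h Δ I hI o ho.1 hm

/-- A set of defeasible inclusions that is its own set of exceptional axioms occurs in the
sequence of `rankPair` only as the empty set. -/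
theorem iterate_eq_nil_of_exc_eq {T : TBox} {D : DBox} {i : ℕ}
    (h : exc (rankPair T D).1 ((exc (rankPair T D).1)^[i] (rankPair T D).2) =
      (exc (rankPair T D).1)^[i] (rankPair T D).2) :
    (exc (rankPair T D).1)^[i] (rankPair T D).2 = [] := by
  obtain ⟨n, hn⟩ := exists_iterate_rankPair T D i
  rwa [Function.iterate_fixed h] at hn

/-- Let `i` be the stage where the search stops. If `C` is inconsistent there, the stage is a fixed
point, hence empty, and `C` has rank `∞`. Otherwise both conjunctions have rank at least `i`. If
stage `i` entails `D` from `C`, then `C ⊓ D` has rank `i` and `C ⊓ ¬D` a larger one; if not, `C ⊓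
¬D` has rank `i` and the strict inequality fails. -/
theorem inRC_iff (K : KB) (C D : EL) :
    InRC K C D ↔ sub (rankPair K.tbox K.dbox).1
      (search (rankPair K.tbox K.dbox).1 C (rankPair K.tbox K.dbox).2) C D = true := by
  obtain ⟨i, h₁, h₂, h₃⟩ := search_spec (rankPair K.tbox K.dbox).1 C (rankPair K.tbox K.dbox).2
  have hexc := exceptional_remaining_iff K
  have hnil := iterate_eq_nil_of_exc_eq (T := K.tbox) (D := K.dbox) (i := i)
  rw [h₁] at h₃ ⊢
  generalize (rankPair K.tbox K.dbox).1 = T at *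
  generalize (rankPair K.tbox K.dbox).2 = E at *
  simp only [sub_iff] at *
  by_cases hs : MatEntails T ((exc T)^[i] E) C.toALC .bot
  · have hE := hnil (h₃ hs)
    refine iff_of_true (.inr (top_le_iff.1 (le_rank fun j _ => (hexc j _).2 ?_))) ?_
    · rw [hE] at hs
      exact hs.mono (List.nil_subset _)
    · exact fun Δ _ I hI o ho hm => (hs Δ I hI o ho hm).elim
  · have hlt : ∀ j : ℕ, (j : ℕ∞) < i → MatEntails T ((exc T)^[j] E) C.toALC .bot :=
      fun j hj => h₂ j (by exact_mod_cast hj)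
    have hC : rank K C.toALC ≠ ⊤ :=
      ne_top_of_le_ne_top (ENat.natCast_ne_top i) (rank_le fun h => hs ((hexc i _).1 h))
    have hle : (i : ℕ∞) ≤ rank K (.inf C.toALC D.toALC) :=
      le_rank fun j hj => (hexc j _).2 (matEntails_inf_left _ (hlt j hj))
    rw [InRC, or_iff_left hC]
    constructor
    · intro h
      by_contra hD
      rw [← matEntails_inf_neg] at hD
      exact absurd (h.trans_le (rank_le fun h' => hD ((hexc i _).1 h'))) (not_lt.2 hle)
    · intro h
      have h' : rank K (.inf C.toALC D.toALC) ≤ i := by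
        refine rank_le fun h' => hs ?_
        rw [hexc] at h'
        exact fun Δ _ I hI o ho hm => h' Δ I hI o ⟨ho, h Δ I hI o ho hm⟩ hm
      have h'' : ((i + 1 : ℕ) : ℕ∞) ≤ rank K (.inf C.toALC (.neg D.toALC)) := by
        refine le_rank fun j hj => (hexc j _).2 ?_
        have hj : j < i + 1 := by exact_mod_cast hj
        rcases Nat.lt_succ_iff_lt_or_eq.1 hj with hj | rfl
        · exact matEntails_inf_left _ (hlt j (by exact_mod_cast hj))
        · rwa [matEntails_inf_neg]
      exact h'.trans_lt (lt_of_lt_of_le (by exact_mod_cast Nat.lt_succ_self i) h'')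

theorem result_rationalClosure (K : KB) (C D : EL) :
    (rationalClosure K C D).result = true ↔ InRC K C D := by
  rw [inRC_iff]
  obtain ⟨i, h₁, h₂, h₃⟩ := search_spec (rankPair K.tbox K.dbox).1 C (rankPair K.tbox K.dbox).2
  have hT := (rankPair_spec K.tbox K.dbox).2.1
  have hnil := iterate_eq_nil_of_exc_eq (T := K.tbox) (D := K.dbox) (i := i)
  have hlim := excLimit_rankPair K.tbox K.dbox
  simp only [rationalClosure, Proc.result_bind, result_ask_eq]
  split_ifs with hKT
  · refine iff_of_true hKT ?_
    rw [sub_iff] at hKT ⊢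
    exact fun Δ _ I hI o ho _ => hKT Δ I (fun g hg => hI g (hT hg)) o ho (by simp)
  · simp only [Proc.result_bind, result_computeRanking, result_ask_eq]
    rw [← h₁] at hnil
    generalize (rankPair K.tbox K.dbox).1 = T at *
    generalize (rankPair K.tbox K.dbox).2 = E at *
    split_ifs with hTs
    · refine iff_of_true hTs ?_
      rw [sub_iff] at hTs ⊢
      exact hTs.mono (List.nil_subset _)
    · simp only [Proc.result_bind, result_rankSearch T C D E hlim]
      obtain ⟨f₁, f₂, f₃⟩ := freshAtom_spec T (search T C E) [C, D]
      rw [result_ask_withDelta f₁ f₂ (f₃ C (by simp)) (Nat.zero_le _)]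
      split_ifs with hb
      · rw [result_ask_withDelta f₁ f₂ (f₃ C (by simp)) (f₃ D (by simp))]
      -- This branch cannot occur: an inconsistent `C` at the last stage, which is empty, means that
      -- the enlarged TBox entails `C ⊑ ⊥`, and then the second plain test would have succeeded.
      · simp only [Bool.not_eq_true', Bool.not_eq_false] at hb
        have hE := hnil (h₃ hb)
        rw [hE, sub_iff] at hb
        refine absurd ?_ hTs
        rw [sub_iff]
        exact fun Δ _ I hI o ho hm => (hb Δ I hI o ho hm).elim

end DefeasibleEL

namespace DefeasibleEL
open Enc (enc)

/-! ## The ranking and the rational closure in polynomial time -/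

@[fun_prop]
theorem poly_exc {α : Type} [Enc α] {T : α → TBox} {E : α → DBox} (hT : Poly T) (hE : Poly E) :
    Poly fun a => exc (T a) (E a) := by
  unfold exc
  fun_prop

@[fun_prop]
theorem poly_diff {α : Type} [Enc α] {E E' : α → DBox} (hE : Poly E) (hE' : Poly E') :
    Poly fun a => (E a).diff (E' a) := by
  have h : Poly fun a => (E a).filter fun d => !decide (d ∈ E' a) := by fun_prop
  exact h.congr fun a => by simp [DBox.diff]

@[fun_prop]
theorem poly_emptyAxioms {α : Type} [Enc α] {E : α → DBox} (hE : Poly E) :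
    Poly fun a => emptyAxioms (E a) := by
  unfold emptyAxioms
  fun_prop

theorem poly_excLimit_prod : Poly fun s : TBox × DBox => (s.1, excLimit s.1 s.2) := by
  refine Poly.loop (c := fun s : TBox × DBox => !decide (exc s.1 s.2 = s.2))
    (b := fun s => (s.1, exc s.1 s.2)) (by fun_prop) (by fun_prop) .id
    (fun s => (s.1, excLimit s.1 s.2)) (fun s hs => ?_) (fun s hs => ?_)
    (fun a s => s.1 = a.1 ∧ s.2.Sublist a.2) (fun s => s.2.length) PolyBdd.esize
    (fun a => ⟨rfl, List.Sublist.refl _⟩) (fun a s hI hs => ?_) (fun a s hI => ?_)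
  · simp only [Bool.not_eq_false', decide_eq_true_eq] at hs
    rw [excLimit, dif_pos hs]
  · simp only [Bool.not_eq_true', decide_eq_false_iff_not] at hs
    rw [excLimit.eq_def s.1 s.2, dif_neg hs]
  · simp only [Bool.not_eq_true', decide_eq_false_iff_not] at hs
    exact ⟨⟨hI.1, (exc_sublist _ _).trans hI.2⟩, exc_length_lt hs⟩
  · have := esize_sublist hI.2
    have := length_lt_esize s.2
    simp only [esize_prod, hI.1]
    omega

@[fun_prop]
theorem poly_excLimit {α : Type} [Enc α] {T : α → TBox} {E : α → DBox} (hT : Poly T)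
    (hE : Poly E) : Poly fun a => excLimit (T a) (E a) :=
  Poly.snd.comp (poly_excLimit_prod.comp (g := fun a => (T a, E a)) (by fun_prop))

/-- The factor `2` is needed since the code of `⊥` has size `5` and may exceed that of the
right-hand side it replaces. -/
theorem esize_emptyAxioms_le (E : DBox) : esize (emptyAxioms E) + 1 ≤ 2 * esize E := by
  induction E with
  | nil => simp [emptyAxioms]
  | cons d E ih =>
    have h₁ : esize (GCI.mk d.lhs .bot) = esize d.lhs + 6 := rfl
    have h₂ : esize d = esize d.lhs + esize d.rhs + 1 := rfl
    have := esize_pos d.lhs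
    have := esize_pos d.rhs
    simp only [emptyAxioms, List.map_cons, esize_cons] at ih ⊢
    omega

theorem esize_filter_add {α : Type} [Enc α] (l : List α) (p : α → Bool) :
    esize (l.filter p) + esize (l.filter fun x => !p x) = esize l + 1 := by
  induction l with
  | nil => simp
  | cons x l ih =>
    cases h : p x <;> simp [h] <;> omega

theorem esize_diff_add {E E' : DBox} (h : E'.Sublist E) :
    esize (E.diff E') + esize E' ≤ esize E + 1 := by
  have h₁ := esize_filter_add E fun d => decide (d ∈ E')
  have h₂ : E.diff E' = E.filter fun d => !decide (d ∈ E') := by simp [DBox.diff]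
  have h₃ : E'.filter (fun d => decide (d ∈ E')) = E' := by simp
  have h₄ := esize_sublist (h.filter fun d => decide (d ∈ E'))
  rw [h₃] at h₄
  rw [h₂]
  omega

/-- The size of the TBox plus twice that of the DBox is a potential: what leaves the DBox pays for
what enters the TBox. This keeps the enlarged TBox linear in the input, for both the running time
and the sizes of the tests. -/
theorem esize_rankingStep_le (T : TBox) {D E : DBox} (h : E.Sublist D) :
    esize (T ++ emptyAxioms E) + 2 * esize (D.diff E) ≤ esize T + 2 * esize D := by
  have := esize_append T (emptyAxioms E)
  have := esize_emptyAxioms_le E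
  have := esize_diff_add h
  omega

theorem poly_rankPair_prod : Poly fun s : TBox × DBox => rankPair s.1 s.2 := by
  refine Poly.loop (c := fun s : TBox × DBox => !(excLimit s.1 s.2).isEmpty)
    (b := fun s => (s.1 ++ emptyAxioms (excLimit s.1 s.2), s.2.diff (excLimit s.1 s.2)))
    (by fun_prop) (by fun_prop) .id
    (fun s => rankPair s.1 s.2) (fun s hs => ?_) (fun s hs => ?_)
    (fun a s => esize s.1 + 2 * esize s.2 ≤ esize a.1 + 2 * esize a.2) (fun s => s.2.length)
    (PolyBdd.esize.add .esize) (fun a => le_rfl) (fun a s hI hs => ?_) (fun a s hI => ?_)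
  · simp only [Bool.not_eq_false', List.isEmpty_iff] at hs
    rw [rankPair, dif_pos hs]
  · simp only [Bool.not_eq_true', List.isEmpty_eq_false_iff] at hs
    rw [rankPair.eq_def s.1 s.2, dif_neg hs]
  · simp only [Bool.not_eq_true', List.isEmpty_eq_false_iff] at hs
    exact ⟨(esize_rankingStep_le _ (excLimit_sublist _ _)).trans hI,
      DBox.diff_length_lt (excLimit_sublist _ _) hs⟩
  · have := length_lt_esize s.2
    simp only [esize_prod]
    omega

@[fun_prop]
theorem poly_rankPair {α : Type} [Enc α] {T : α → TBox} {D : α → DBox} (hT : Poly T)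
    (hD : Poly D) : Poly fun a => rankPair (T a) (D a) :=
  poly_rankPair_prod.comp (g := fun a => (T a, D a)) (by fun_prop)

@[fun_prop]
theorem poly_excRanks {α : Type} [Enc α] {T : α → TBox} {E : α → DBox} (hT : Poly T)
    (hE : Poly E) : Poly fun a => excRanks (T a) (E a) := by
  -- The layers are collected in an accumulator; `[] ++` is its initial value in the form required
  -- by the loop rule. The invariant bounds the number of layers by the length lost so far, and the
  -- size of each layer by that of `E a`.
  have h : Poly fun a => (((T a, excLimit (T a) (E a), [] ++ excRanks (T a) (E a)) : TBox × DBox × List DBox)) := by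
    refine Poly.loop (α := α) (σ := TBox × DBox × List DBox)
      (c := fun s => !decide (exc s.1 s.2.1 = s.2.1))
      (b := fun s => (s.1, exc s.1 s.2.1, s.2.2 ++ [s.2.1.diff (exc s.1 s.2.1)])) (by fun_prop)
      (by fun_prop) (init := fun a => (T a, E a, ([] : List DBox))) (by fun_prop)
      (fun s => (s.1, excLimit s.1 s.2.1, s.2.2 ++ excRanks s.1 s.2.1))
      (fun s hs => ?_) (fun s hs => ?_)
      (fun a s => s.1 = T a ∧ s.2.1.Sublist (E a) ∧ s.2.2.length + s.2.1.length ≤ (E a).length ∧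
        ∀ F ∈ s.2.2, esize F ≤ esize (E a)) (fun s => s.2.1.length)
      ((hT.esize_le.add hE.esize_le).add
        ((hE.esize_le.mul (hE.esize_le.add (.const 1))).add (.const 3)))
      (fun a => ⟨rfl, List.Sublist.refl _, by simp, by simp⟩) (fun a s hI hs => ?_)
      (fun a s hI => ?_)
    · simp only [Bool.not_eq_false', decide_eq_true_eq] at hs
      rw [excLimit, dif_pos hs, excRanks_of_eq hs]
      simp
    · simp only [Bool.not_eq_true', decide_eq_false_iff_not] at hs
      rw [excLimit.eq_def s.1 s.2.1, dif_neg hs, excRanks_of_ne hs]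
      simp
    · simp only [Bool.not_eq_true', decide_eq_false_iff_not] at hs
      obtain ⟨h₁, h₂, h₃, h₄⟩ := hI
      have hlt := exc_length_lt hs
      refine ⟨⟨h₁, (exc_sublist _ _).trans h₂, by simp; omega, fun F hF => ?_⟩, hlt⟩
      rcases List.mem_append.1 hF with hF | hF
      · exact h₄ F hF
      · rw [List.mem_singleton.1 hF]
        exact esize_sublist (List.filter_sublist.trans h₂)
    · obtain ⟨h₁, h₂, h₃, h₄⟩ := hI
      have := esize_sublist h₂
      have h₅ := esize_le_of_forall h₄
      have := length_lt_esize (E a)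
      have := Nat.mul_le_mul_right (esize (E a) + 1)
        (show s.2.2.length ≤ esize (E a) by omega)
      simp only [esize_prod, h₁]
      omega
  exact (Poly.snd.comp (Poly.snd.comp h)).congr fun a => List.nil_append _

theorem poly_computeRanking : Poly fun K : KB => (computeRanking K).result := by
  simp only [result_computeRanking]
  fun_prop

@[fun_prop]
theorem poly_search {α : Type} [Enc α] {T : α → TBox} {C : α → EL} {E : α → DBox} (hT : Poly T)
    (hC : Poly C) (hE : Poly E) : Poly fun a => search (T a) (C a) (E a) := by
  have h : Poly fun a => (((T a, C a, search (T a) (C a) (E a)) : TBox × EL × DBox)) := by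
    refine Poly.loop (α := α) (σ := TBox × EL × DBox)
      (c := fun s => sub s.1 s.2.2 s.2.1 .bot && !decide (exc s.1 s.2.2 = s.2.2))
      (b := fun s => (s.1, s.2.1, exc s.1 s.2.2)) (by fun_prop)
      (by fun_prop) (init := fun a => (T a, C a, E a)) (by fun_prop)
      (fun s => (s.1, s.2.1, search s.1 s.2.1 s.2.2))
      (fun s hs => ?_) (fun s hs => ?_)
      (fun a s => s.1 = T a ∧ s.2.1 = C a ∧ s.2.2.Sublist (E a)) (fun s => s.2.2.length)
      ((hT.esize_le.add (hC.esize_le.add hE.esize_le)).add (.const 2))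
      (fun a => ⟨rfl, rfl, List.Sublist.refl _⟩) (fun a s hI hs => ?_) (fun a s hI => ?_)
    · rw [search, dif_neg]
      simpa using hs
    · rw [search.eq_def s.1 s.2.1 s.2.2, dif_pos]
      simpa using hs
    · obtain ⟨h₁, h₂, h₃⟩ := hI
      exact ⟨⟨h₁, h₂, (exc_sublist _ _).trans h₃⟩, exc_length_lt (by simp at hs; exact hs.2)⟩
    · obtain ⟨h₁, h₂, h₃⟩ := hI
      have := esize_sublist h₃
      have := length_lt_esize s.2.2
      simp only [esize_prod, h₁, h₂]
      omega
  exact Poly.snd.comp (Poly.snd.comp h)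

theorem poly_inRC : Poly fun a : KB × DGCI =>
    sub (rankPair a.1.tbox a.1.dbox).1
      (search (rankPair a.1.tbox a.1.dbox).1 a.2.lhs (rankPair a.1.tbox a.1.dbox).2)
      a.2.lhs a.2.rhs := by
  fun_prop

theorem Poly.computableInPolyTime {α β : Type} [Enc α] [Enc β] {f : α → β} (hf : Poly f) :
    ComputableInPolyTime enc enc f := by
  obtain ⟨p, k, q, -, h⟩ := hf
  refine ⟨p, q, fun a => ?_⟩
  obtain ⟨s, t, hr, ho, -, ht, -⟩ := h a (inputStore (enc a)) rfl
  exact ⟨s, t, hr, ht, ho⟩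

theorem Poly.decidableInPolyTime {α : Type} [Enc α] {f : α → Bool} (hf : Poly f) {P : α → Prop}
    (hP : ∀ a, P a ↔ f a = true) : DecidableInPolyTime enc P := by
  obtain ⟨p, q, h⟩ := hf.computableInPolyTime
  refine ⟨p, q, fun a => ?_⟩
  obtain ⟨s, t, hr, ht, ho⟩ := h a
  refine ⟨s, t, hr, ht, ?_⟩
  rw [ho, hP]
  cases f a <;> simp [enc, encodeBit]

end DefeasibleEL

namespace DefeasibleEL
open Enc (enc)

/-! ## The number of tests -/

theorem length_tests_exceptional (T : TBox) (E : DBox) :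
    (exceptional T E).tests.length = E.length := by
  rw [exceptional]
  generalize freshAtom T E [] = δ
  generalize withDelta T δ E = T'
  induction E with
  | nil => rfl
  | cons d E ih => simp [exceptionalLoop, ih]

theorem tests_exceptionalChain (T : TBox) (E : DBox) : (exceptionalChain T E).tests =
    (exceptional T E).tests ++ if exc T E = E then [] else
      (exceptionalChain T (exc T E)).tests := by
  have he := result_exceptional T E
  rw [exceptionalChain]
  simp only [Proc.tests_bind]
  congr 1
  split
  next h =>
    rw [he] at h
    simp [h]
  next h =>
    rw [he] at h
    rw [if_neg h, ← he]
    simp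

theorem tests_rankingLoop (T : TBox) (D : DBox) : (rankingLoop T D).tests =
    (exceptionalChain T D).tests ++ if excLimit T D = [] then [] else
      (rankingLoop (T ++ emptyAxioms (excLimit T D)) (D.diff (excLimit T D))).tests := by
  have he := result_exceptionalChain T D
  rw [rankingLoop]
  simp only [Proc.tests_bind]
  congr 1
  split
  next h =>
    rw [he.2] at h
    simp [h]
  next h =>
    rw [he.2] at h
    rw [if_neg h, ← he.2]
    rfl

/-- Every further call receives a strictly shorter list, and `n + (n - 1)² ≤ n²` for `n ≥ 1`. -/
theorem length_tests_exceptionalChain (T : TBox) (E : DBox) :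
    (exceptionalChain T E).tests.length ≤ E.length ^ 2 := by
  induction hn : E.length using Nat.strong_induction_on generalizing E with
  | _ n ih =>
    subst hn
    rw [tests_exceptionalChain, List.length_append, length_tests_exceptional]
    split_ifs with h
    · simpa using Nat.le_self_pow two_ne_zero _
    · have := ih _ (exc_length_lt h) _ rfl
      have := exc_length_lt h
      nlinarith

/-- Every further round has a strictly shorter DBox, and `n² + (n - 1)³ ≤ n³` for `n ≥ 1`. -/
theorem length_tests_rankingLoop (T : TBox) (D : DBox) :
    (rankingLoop T D).tests.length ≤ D.length ^ 3 := by
  induction hn : D.length using Nat.strong_induction_on generalizing T D with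
  | _ n ih =>
    subst hn
    have h₁ := length_tests_exceptionalChain T D
    rw [tests_rankingLoop, List.length_append]
    split_ifs with h
    · have : D.length ^ 2 ≤ D.length ^ 3 := by
        rcases Nat.eq_zero_or_pos D.length with h | h
        · simp [h]
        · exact Nat.pow_le_pow_right h (by norm_num)
      simpa using h₁.trans this
    · have hlt := DBox.diff_length_lt (excLimit_sublist T D) h
      have h₂ := ih _ hlt (T ++ emptyAxioms (excLimit T D)) _ rfl
      obtain ⟨m, hm⟩ : ∃ m, List.length D = m + 1 := ⟨List.length D - 1, by omega⟩
      have h₃ : (List.length (D.diff (excLimit T D))) ^ 3 ≤ m ^ 3 :=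
        Nat.pow_le_pow_left (by omega) 3
      rw [hm] at h₁ ⊢
      nlinarith

theorem length_excRanks_le (T : TBox) (E : DBox) : (excRanks T E).length ≤ E.length := by
  induction hn : E.length using Nat.strong_induction_on generalizing E with
  | _ n ih =>
    subst hn
    by_cases h : exc T E = E
    · simp [excRanks_of_eq h]
    · have := ih _ (exc_length_lt h) _ rfl
      have := exc_length_lt h
      rw [excRanks_of_ne h, List.length_cons]
      omega

theorem length_tests_rankSearch (T : TBox) (C D : EL) (l : List DBox) (E : DBox) :
    (rankSearch T C D l E).tests.length ≤ l.length + 1 := by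
  induction l generalizing E with
  | nil => simp [rankSearch]
  | cons F l ih =>
    simp only [rankSearch, Proc.tests_bind, tests_ask, List.length_append, List.length_cons,
      List.length_nil]
    split_ifs
    · have := ih (E.diff F)
      omega
    · simp

/-- The constant `5` counts the two plain tests, the final guard of the search loop and the two
tests after it. -/
theorem length_tests_rationalClosure (K : KB) (C D : EL) :
    (rationalClosure K C D).tests.length ≤ K.dbox.length ^ 3 + K.dbox.length + 5 := by
  have h₁ : (computeRanking K).tests.length ≤ K.dbox.length ^ 3 := length_tests_rankingLoop _ _
  have h₂ := length_tests_rankSearch (computeRanking K).result.tbox C D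
    (computeRanking K).result.ranks (computeRanking K).result.dbox
  have h₃ : (computeRanking K).result.ranks.length ≤ K.dbox.length := by
    rw [result_computeRanking]
    exact (length_excRanks_le _ _).trans (rankPair_spec _ _).1.length_le
  simp only [rationalClosure, Proc.tests_bind, tests_ask, List.length_append, List.length_cons,
    List.length_nil]
  split_ifs
  · simp
  · simp only [Proc.tests_bind, tests_ask, List.length_append, List.length_cons, List.length_nil]
    split_ifs
    · simp; omega
    · simp only [Proc.tests_bind, tests_ask, List.length_append, List.length_cons,
        List.length_nil]
      split_ifs
      · simp; omega
      · simp; omega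

/-! ## The size of the tests -/

theorem size_le_esize_nat (n : ℕ) : 2 * n.size + 1 ≤ esize n ∧ esize n ≤ 4 * n.size + 1 := by
  rw [← Nat.size_eq_bits_len]
  change 2 * n.bits.length + 1 ≤ esize n.bits ∧ esize n.bits ≤ 4 * n.bits.length + 1
  induction n.bits with
  | nil => simp
  | cons b l ih =>
    have := esize_bool b
    have := esize_pos b
    simp only [List.length_cons, esize_cons]
    omega

theorem size_max_le {m n k : ℕ} (hm : m.size ≤ k) (hn : n.size ≤ k) : (max m n).size ≤ k := by
  rcases max_choice m n with h | h <;> rwa [h]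

/-- The index of the fresh atom may be exponential in the size of the input, but names are written
in binary, so only its bit length has to be bounded. -/
theorem size_bound_le (C : EL) : C.bound.size ≤ esize C := by
  induction C with
  | atom A =>
    have h₁ : (A + 1).size ≤ A.size + 1 := by
      rw [Nat.size_le, pow_succ]
      have := Nat.lt_size_self A
      omega
    have h₂ := (size_le_esize_nat A).1
    have h₃ : esize (EL.atom A) = 5 + esize A + 1 := rfl
    simp only [EL.bound]
    omega
  | top => simp [EL.bound]
  | bot => simp [EL.bound]
  | inf C D ih ih' =>
    have h : esize (EL.inf C D) = 7 + (esize C + esize D + 1) + 1 := rfl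
    exact size_max_le (by omega) (by omega)
  | ex r C ih =>
    have h : esize (EL.ex r C) = 9 + (esize r + esize C + 1) + 1 := rfl
    simp only [EL.bound]
    omega

theorem size_foldr_max_le {l : List ℕ} {k : ℕ} (h : ∀ n ∈ l, n.size ≤ k) :
    (l.foldr max 0).size ≤ k := by
  induction l with
  | nil => simp
  | cons n l ih => exact size_max_le (h n (by simp)) (ih fun m hm => h m (by simp [hm]))

theorem size_freshAtom_le (T : TBox) (E : DBox) (Cs : List EL) :
    (freshAtom T E Cs).size ≤ esize T + esize E + esize Cs := by
  refine size_foldr_max_le fun n hn => ?_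
  simp only [List.mem_append, List.mem_map] at hn
  rcases hn with (⟨g, hg, rfl⟩ | ⟨d, hd, rfl⟩) | ⟨C, hC, rfl⟩
  · have h₁ := esize_mem hg
    have h₂ : esize g = esize g.lhs + esize g.rhs + 1 := rfl
    have h₃ := size_bound_le g.lhs
    have h₄ := size_bound_le g.rhs
    exact size_max_le (by omega) (by omega)
  · have h₁ := esize_mem hd
    have h₂ : esize d = esize d.lhs + esize d.rhs + 1 := rfl
    have h₃ := size_bound_le d.lhs
    have h₄ := size_bound_le d.rhs
    exact size_max_le (by omega) (by omega)
  · have h₁ := esize_mem hC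
    have h₂ := size_bound_le C
    omega

/-- The bound is quadratic because each of up to `M` axioms receives its own copy of `δ`, whose code
has size at most `4 * M + 1`. -/
theorem esize_test_le {T : TBox} {E : DBox} {C D : EL} {δ M : ℕ} (hδ : δ.size ≤ M)
    (hM : esize T + esize E + esize C + esize D ≤ M) :
    esize (withDelta T δ E, GCI.mk (.inf C (.atom δ)) D) ≤ 50 * (M + 1) ^ 2 := by
  have h₁ := (size_le_esize_nat δ).2
  have key : ∀ C D : EL, esize (GCI.mk (.inf C (.atom δ)) D) =
      esize C + esize δ + 15 + esize D + 1 := by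
    intro C D
    change 7 + (esize C + (5 + esize δ + 1) + 1) + 1 + esize D + 1 = _
    omega
  have h₂ : ∀ g ∈ E.map fun d => GCI.mk (.inf d.lhs (.atom δ)) d.rhs, esize g ≤ 5 * M + 16 := by
    intro g hg
    obtain ⟨d, hd, rfl⟩ := List.mem_map.1 hg
    have h₃ := esize_mem hd
    have h₄ : esize d = esize d.lhs + esize d.rhs + 1 := rfl
    rw [key]
    omega
  have h₃ := esize_le_of_forall h₂
  have h₄ := length_lt_esize E
  have h₅ := esize_append T (E.map fun d => GCI.mk (.inf d.lhs (.atom δ)) d.rhs)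
  have h₆ := Nat.mul_le_mul_right (5 * M + 16 + 1) (show E.length ≤ M by omega)
  rw [List.length_map] at h₃
  simp only [esize_prod, key, withDelta]
  nlinarith

/-- The hypothesis has the form of the potential in `esize_rankingStep_le`, so it is inherited by
all later rounds of ComputeRanking. The summand `5` is the size of the code of `⊥`. -/
theorem esize_tests_exceptional {T : TBox} {E : DBox} {M : ℕ}
    (hM : esize T + 2 * esize E + 5 ≤ M) :
    ∀ τ ∈ (exceptional T E).tests, esize τ ≤ 50 * (M + 1) ^ 2 := by
  have hδ := size_freshAtom_le T E []
  rw [exceptional]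
  generalize freshAtom T E [] = δ at *
  have key : ∀ E' ⊆ E, ∀ τ ∈ (exceptionalLoop (withDelta T δ E) δ E').tests,
      ∃ d ∈ E, τ = (withDelta T δ E, ⟨.inf d.lhs (.atom δ), .bot⟩) := by
    intro E'
    induction E' with
    | nil => intro _ τ hτ; simp [exceptionalLoop] at hτ
    | cons d E' ih =>
      intro hE' τ hτ
      simp only [List.cons_subset] at hE'
      simp only [exceptionalLoop, Proc.tests_bind, tests_ask, Proc.tests_pure, List.append_nil,
        List.mem_append, List.mem_singleton] at hτ
      rcases hτ with rfl | hτ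
      · exact ⟨d, hE'.1, rfl⟩
      · exact ih hE'.2 τ hτ
  intro τ hτ
  obtain ⟨d, hd, rfl⟩ := key E (List.Subset.refl E) τ hτ
  have h₁ := esize_mem hd
  have h₂ : esize d = esize d.lhs + esize d.rhs + 1 := rfl
  have h₃ : esize EL.bot = 5 := rfl
  simp only [esize_nil] at hδ
  exact esize_test_le (by omega) (by omega)

theorem esize_tests_exceptionalChain {T : TBox} {E : DBox} {M : ℕ}
    (hM : esize T + 2 * esize E + 5 ≤ M) :
    ∀ τ ∈ (exceptionalChain T E).tests, esize τ ≤ 50 * (M + 1) ^ 2 := by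
  induction hn : E.length using Nat.strong_induction_on generalizing E with
  | _ n ih =>
    subst hn
    intro τ hτ
    rw [tests_exceptionalChain, List.mem_append] at hτ
    rcases hτ with hτ | hτ
    · exact esize_tests_exceptional hM τ hτ
    · split_ifs at hτ with h
      · simp at hτ
      · have := esize_sublist (exc_sublist T E)
        exact ih _ (exc_length_lt h) (by omega) rfl τ hτ

theorem esize_tests_rankingLoop {T : TBox} {D : DBox} {M : ℕ}
    (hM : esize T + 2 * esize D + 5 ≤ M) :
    ∀ τ ∈ (rankingLoop T D).tests, esize τ ≤ 50 * (M + 1) ^ 2 := by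
  induction hn : D.length using Nat.strong_induction_on generalizing T D with
  | _ n ih =>
    subst hn
    intro τ hτ
    rw [tests_rankingLoop, List.mem_append] at hτ
    rcases hτ with hτ | hτ
    · exact esize_tests_exceptionalChain hM τ hτ
    · split_ifs at hτ with h
      · simp at hτ
      · have := esize_rankingStep_le T (excLimit_sublist T D)
        exact ih _ (DBox.diff_length_lt (excLimit_sublist T D) h) (by omega) rfl τ hτ

theorem esize_rankPair_le (T : TBox) (D : DBox) :
    esize (rankPair T D).1 + 2 * esize (rankPair T D).2 ≤ esize T + 2 * esize D := by
  induction hn : D.length using Nat.strong_induction_on generalizing T D with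
  | _ n ih =>
    subst hn
    rw [rankPair]
    split_ifs with h
    · exact le_rfl
    · exact (ih _ (DBox.diff_length_lt (excLimit_sublist T D) h) _ _ rfl).trans
        (esize_rankingStep_le T (excLimit_sublist T D))

theorem esize_tests_rankSearch {T : TBox} {C D : EL} {l : List DBox} {E : DBox} {M : ℕ}
    (hM : esize T + esize E + esize C + esize D + 5 ≤ M) :
    (∀ τ ∈ (rankSearch T C D l E).tests, esize τ ≤ 50 * (M + 1) ^ 2) ∧
      (rankSearch T C D l E).result.Sublist E := by
  have hbot : esize EL.bot = 5 := rfl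
  have hD := esize_pos D
  have key : ∀ E : DBox, esize T + esize E + esize C + esize D + 5 ≤ M →
      esize (withDelta T (freshAtom T E [C, D]) E,
        GCI.mk (.inf C (.atom (freshAtom T E [C, D]))) .bot) ≤ 50 * (M + 1) ^ 2 := by
    intro E hM
    have := size_freshAtom_le T E [C, D]
    simp only [esize_cons, esize_nil] at this
    exact esize_test_le (by omega) (by omega)
  induction l generalizing E with
  | nil =>
    simp only [rankSearch, Proc.tests_bind, tests_ask, Proc.tests_pure, List.append_nil,
      List.mem_singleton, Proc.result_bind, Proc.result_pure]
    exact ⟨by rintro _ rfl; exact key E hM, List.Sublist.refl E⟩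
  | cons F l ih =>
    have hs : (E.diff F).Sublist E := List.filter_sublist
    have := esize_sublist hs
    obtain ⟨h₁, h₂⟩ := ih (E := E.diff F) (by omega)
    simp only [rankSearch, Proc.tests_bind, tests_ask, List.mem_append,
      List.mem_singleton, Proc.result_bind]
    split_ifs
    · refine ⟨?_, h₂.trans hs⟩
      rintro τ (rfl | hτ)
      · exact key E hM
      · exact h₁ τ hτ
    · refine ⟨?_, List.Sublist.refl E⟩
      rintro τ (rfl | hτ)
      · exact key E hM
      · simp at hτ

theorem esize_tests_rationalClosure {K : KB} {C D : EL} {M : ℕ}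
    (hM : esize K.tbox + 2 * esize K.dbox + esize C + esize D + 5 ≤ M) :
    ∀ τ ∈ (rationalClosure K C D).tests, esize τ ≤ 50 * (M + 1) ^ 2 := by
  have hr := esize_rankPair_le K.tbox K.dbox
  have h₁ : ∀ τ ∈ (computeRanking K).tests, esize τ ≤ 50 * (M + 1) ^ 2 :=
    esize_tests_rankingLoop (by omega)
  have hplain : ∀ T : TBox, esize T + esize C + esize D ≤ M →
      esize (T, GCI.mk C D) ≤ 50 * (M + 1) ^ 2 := by
    intro T hT
    have h : esize (GCI.mk C D) = esize C + esize D + 1 := rfl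
    simp only [esize_prod, h]
    nlinarith
  have hb : esize EL.bot = 5 := rfl
  have hD := esize_pos D
  intro τ hτ
  simp only [rationalClosure, Proc.tests_bind, tests_ask, List.mem_append,
    List.mem_singleton] at hτ
  rcases hτ with rfl | hτ
  · exact hplain _ (by omega)
  split_ifs at hτ
  · simp at hτ
  simp only [Proc.tests_bind, tests_ask, List.mem_append, List.mem_singleton] at hτ
  rcases hτ with hτ | rfl | hτ
  · exact h₁ τ hτ
  · rw [result_computeRanking]
    exact hplain _ (by simp only; omega)
  split_ifs at hτ
  · simp at hτ
  rw [result_computeRanking] at hτ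
  simp only [Proc.tests_bind, tests_ask, List.mem_append, List.mem_singleton] at hτ
  obtain ⟨h₂, h₃⟩ := esize_tests_rankSearch (T := (rankPair K.tbox K.dbox).1) (C := C) (D := D)
    (E := (rankPair K.tbox K.dbox).2) (M := M)
    (l := excRanks (rankPair K.tbox K.dbox).1 (rankPair K.tbox K.dbox).2) (by omega)
  have h₄ := esize_sublist h₃
  generalize (rankSearch (rankPair K.tbox K.dbox).1 C D
    (excRanks (rankPair K.tbox K.dbox).1 (rankPair K.tbox K.dbox).2)
    (rankPair K.tbox K.dbox).2).result = E at *
  have h₅ := size_freshAtom_le (rankPair K.tbox K.dbox).1 E [C, D]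
  simp only [esize_cons, esize_nil] at h₅
  rcases hτ with hτ | rfl | hτ
  · exact h₂ τ hτ
  · exact esize_test_le (by omega) (by omega)
  · split_ifs at hτ
    · rw [tests_ask, List.mem_singleton] at hτ
      subst hτ
      exact esize_test_le (by omega) (by omega)
    · simp at hτ

end DefeasibleEL

/-! ### The main theorem -/

theorem mainTheorem2 :
    -- number of classical subsumption tests
    (∃ c : ℕ, ∀ K : DefeasibleEL.KB,
      (DefeasibleEL.computeRanking K).tests.length ≤ c * K.dbox.length ^ 3) ∧
    (∃ c : ℕ, ∀ (K : DefeasibleEL.KB) (C D : DefeasibleEL.EL),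
      (DefeasibleEL.rationalClosure K C D).tests.length ≤
        c * max 1 (K.dbox.length ^ 3 + K.dbox.length)) ∧
    -- all the tests are of polynomial size
    (∃ q : Polynomial ℕ, ∀ K : DefeasibleEL.KB,
      ∀ τ ∈ (DefeasibleEL.computeRanking K).tests,
        (DefeasibleEL.encodeTest τ).size ≤ q.eval (DefeasibleEL.encodeKB K).size) ∧
    (∃ q : Polynomial ℕ, ∀ (K : DefeasibleEL.KB) (C D : DefeasibleEL.EL),
      ∀ τ ∈ (DefeasibleEL.rationalClosure K C D).tests,
        (DefeasibleEL.encodeTest τ).size ≤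
          q.eval (DefeasibleEL.encodeInput (K, ⟨C, D⟩)).size) ∧
    -- RationalClosure decides membership in the rational closure
    (∀ (K : DefeasibleEL.KB) (C D : DefeasibleEL.EL),
      (DefeasibleEL.rationalClosure K C D).result = true ↔ DefeasibleEL.InRC K C D) ∧
    -- polynomial time
    DefeasibleEL.ComputableInPolyTime DefeasibleEL.encodeKB DefeasibleEL.encodeRanking
      (fun K => (DefeasibleEL.computeRanking K).result) ∧
    DefeasibleEL.DecidableInPolyTime DefeasibleEL.encodeInput
      (fun a => DefeasibleEL.InRC a.1 a.2.lhs a.2.rhs) := by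
  have hK : ∀ K : DefeasibleEL.KB, (DefeasibleEL.encodeKB K).size =
      DefeasibleEL.esize K.tbox + DefeasibleEL.esize K.dbox + 1 := fun _ => rfl
  -- The factor `6` absorbs the five additional tests into `max 1 _`. The polynomial `2 * .X + 6` is
  -- `M + 1` for `M` equal to twice the input size plus `5`.
  refine ⟨⟨1, fun K => ?_⟩, ⟨6, fun K C D => ?_⟩, ⟨50 * (2 * .X + 6) ^ 2, fun K τ hτ => ?_⟩,
    ⟨50 * (2 * .X + 6) ^ 2, fun K C D τ hτ => ?_⟩, DefeasibleEL.result_rationalClosure,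
    DefeasibleEL.poly_computeRanking.computableInPolyTime,
    DefeasibleEL.poly_inRC.decidableInPolyTime fun a => DefeasibleEL.inRC_iff _ _ _⟩
  · rw [one_mul]
    exact DefeasibleEL.length_tests_rankingLoop _ _
  · have := DefeasibleEL.length_tests_rationalClosure K C D
    omega
  · refine (DefeasibleEL.esize_tests_rankingLoop
      (M := 2 * (DefeasibleEL.encodeKB K).size + 5) ?_ τ hτ).trans (le_of_eq ?_)
    · rw [hK]
      omega
    · simp
  · have hI : (DefeasibleEL.encodeInput (K, ⟨C, D⟩)).size = (DefeasibleEL.encodeKB K).size +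
        (DefeasibleEL.esize C + DefeasibleEL.esize D + 1) + 1 := rfl
    refine (DefeasibleEL.esize_tests_rationalClosure
      (M := 2 * (DefeasibleEL.encodeInput (K, ⟨C, D⟩)).size + 5) ?_ τ hτ).trans (le_of_eq ?_)
    · rw [hI, hK]
      omega
    · simp
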